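/- Let $d\ge 3$ and $k\ge 1$ be integers, let $T_d$ be the infinite $d$-regular tree, and let $T_d^k=T_d\times\cdots\times T_d$ be the Cartesian product of $k$ copies of $T_d$ (two $k$-tuples are adjacent when they are adjacent in exactly one component and agree in all the others). Fix a vertex $v^*$ of $T_d^k$; for $r\in\mathbb{N}$ let $B(v^*,r)$ be the set of vertices at graph distance at most $r$ from $v^*$, let $n=n(r)=|B(v^*,r)|$, and let $G_n$ be the subgraph of $T_d^k$ induced by $B(v^*,r)$. Every unordered pair of distinct vertices $u,w\in B(v^*,r)$ exchanges one unit of flow, which is divided equally among all geodesics (shortest paths) joining $u$ and $w$. The traffic load at $v^*$ is the total flow passing through $v^*$, that is, the sum over all such pairs of the fraction of the geodesics joining $u$ and $w$ that contain $v^*$. Then, as $r\to\infty$, with $d$ and $k$ fixed, the traffic load at $v^*$ is $$\Theta\!\left(\frac{n^2}{\big(\log_{d-1} n\big)^{k-1}}\right).$$ This holds both when the geodesics are those of the finite graph $G_n$ and when they are all the geodesics of the infinite graph $T_d^k$ between vertices of $B(v^*,r)$. -/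

import Mathlib

open Filter Asymptotics

namespace ProductTraffic

/-- The `k`-fold product `T × ⋯ × T` of a graph with itself (the Cartesian product, in which the
graph distance is the sum of the distances of the components): two `k`-tuples are adjacent when
they are adjacent in one component and agree in all the others. -/
def power {V : Type*} (T : SimpleGraph V) (k : ℕ) : SimpleGraph (Fin k → V) where
  Adj x y := ∃ i, T.Adj (x i) (y i) ∧ ∀ j, j ≠ i → x j = y j
  symm.symm := fun _ _ ⟨i, h, h'⟩ => ⟨i, h.symm, fun j hj => (h' j hj).symm⟩
  loopless.irrefl := fun _ ⟨_, h, _⟩ => h.ne rfl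

theorem power_neighborSet_finite {V : Type*} (T : SimpleGraph V) [T.LocallyFinite] (k : ℕ)
    (x : Fin k → V) : ((power T k).neighborSet x).Finite := by
  classical
  have h : (⋃ i : Fin k, (Function.update x i) '' (T.neighborSet (x i))).Finite :=
    Set.finite_iUnion fun i => (Set.toFinite _).image _
  refine h.subset ?_
  rintro y ⟨i, hi, hij⟩
  refine Set.mem_iUnion.2 ⟨i, y i, hi, ?_⟩
  funext j
  by_cases hj : j = i
  · subst hj; simp
  · simp [hj, hij j hj]

noncomputable instance powerLocallyFinite {V : Type*} (T : SimpleGraph V) [T.LocallyFinite]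
    (k : ℕ) : (power T k).LocallyFinite :=
  fun x => (power_neighborSet_finite T k x).fintype

theorem closedBall_finite {V : Type*} (G : SimpleGraph V) [G.LocallyFinite] (c : V) (r : ℕ) :
    {x : V | G.edist c x ≤ (r : ℕ∞)}.Finite := by
  have key : ∀ (r : ℕ) (c : V), {x : V | ∃ p : G.Walk c x, p.length ≤ r}.Finite := by
    intro r
    induction r with
    | zero =>
      intro c
      refine (Set.finite_singleton c).subset ?_
      rintro x ⟨p, hp⟩
      exact (SimpleGraph.Walk.eq_of_length_eq_zero (Nat.le_zero.1 hp)).symm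
    | succ r ih =>
      intro c
      have h : (⋃ b ∈ G.neighborSet c, {x : V | ∃ p : G.Walk b x, p.length ≤ r}).Finite :=
        (Set.toFinite (G.neighborSet c)).biUnion fun b _ => ih b
      refine (h.union (Set.finite_singleton c)).subset ?_
      rintro x ⟨p, hp⟩
      cases p with
      | nil => exact Or.inr rfl
      | cons hadj q =>
        refine Or.inl (Set.mem_biUnion hadj ⟨q, ?_⟩)
        simpa using hp
  refine (key r c).subset ?_
  intro x hx
  have hx' : G.edist c x ≤ (r : ℕ∞) := hx
  obtain ⟨p, hp⟩ := SimpleGraph.exists_walk_of_edist_ne_top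
    (ne_top_of_le_ne_top (ENat.natCast_ne_top r) hx')
  exact ⟨p, by rw [← hp] at hx'; exact_mod_cast hx'⟩

/-- The set of vertices at graph distance at most `r` from `c`. -/
noncomputable def closedBall {V : Type*} (G : SimpleGraph V) [G.LocallyFinite] (c : V) (r : ℕ) :
    Finset V :=
  (closedBall_finite G c r).toFinset

theorem mem_closedBall {V : Type*} (G : SimpleGraph V) [G.LocallyFinite] (c x : V) (r : ℕ) :
    x ∈ closedBall G c r ↔ G.edist c x ≤ (r : ℕ∞) := by
  simp [closedBall]

theorem center_mem_closedBall {V : Type*} (G : SimpleGraph V) [G.LocallyFinite] (c : V) (r : ℕ) :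
    c ∈ closedBall G c r := by
  simp [mem_closedBall]

/-- The geodesics of `G` from `u` to `w`: the walks of minimum length. -/
def geodesics {V : Type*} (G : SimpleGraph V) (u w : V) : Set (G.Walk u w) :=
  {p | p.length = G.dist u w}

/-- The part of a unit flow between `u` and `w`, divided equally among the geodesics of `G` joining
them, that passes through `v`. -/
noncomputable def flowThrough {V : Type*} (G : SimpleGraph V) (u w v : V) : ℝ :=
  (Set.ncard {p ∈ geodesics G u w | v ∈ p.support} : ℝ) / (Set.ncard (geodesics G u w) : ℝ)

open scoped Classical in
/-- The traffic load at `v` when each unordered pair of distinct nodes of the finite set `S`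
exchanges one unit of flow along the geodesics of `G`. The sum runs over ordered pairs, whence the
factor `1 / 2`. -/
noncomputable def trafficLoad {V : Type*} (G : SimpleGraph V) (S : Finset V) (v : V) : ℝ :=
  (1 / 2) * ∑ p ∈ S.offDiag, flowThrough G p.1 p.2 v

/-- The subgraph of `G` induced by the ball of radius `r` around `c`. -/
abbrev ballGraph {V : Type*} (G : SimpleGraph V) [G.LocallyFinite] (c : V) (r : ℕ) :
    SimpleGraph {x : V // x ∈ closedBall G c r} :=
  G.comap Subtype.val

/-- The traffic load at the centre `c` of the finite graph induced by the ball of radius `r` around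
`c`, with geodesics taken in that finite graph. -/
noncomputable def ballLoad {V : Type*} (G : SimpleGraph V) [G.LocallyFinite] (c : V) (r : ℕ) : ℝ :=
  trafficLoad (ballGraph G c r) Finset.univ ⟨c, center_mem_closedBall G c r⟩

end ProductTraffic

/-!
A geodesic of `T ^ k` from `u` to `w` is an order in which to perform the steps of the component
geodesics, so with `a` and `b` the tuples of the distances from the components of `u` and `w` to
those of the centre `c`, and with `c` between `u` and `w`, the pair contributes
`M a * M b / M (a + b)`, where `M` is the multinomial coefficient (`geoCount_power`). Writing
`q = d - 1`, there are, up to constant factors, `q ^ (s + t)` pairs for every choice of `a`, `b`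
with sums `s`, `t`. By the Vandermonde identity the quotients sum up, over all `a` and `b` with
sums `s` and `t`, to the number of `k`-tuples with sum `s + t` (`sum_multi_mul_multi_div`), which is
of order `(s + t) ^ (k - 1)`. The pairs with `s = t = r` alone give a load of order at least
`r ^ (k - 1) * q ^ (2 * r)` (`le_trafficLoad`). Since `n` is of order `r ^ (k - 1) * q ^ r` and its
logarithm of order `r`, this is the claimed order of magnitude (`target_isTheta`).

In the finite graph the geodesics that pass through the centre are the same, because the distance
from the centre along them first decreases and then increases (`geoCount_ball_center`), and the
ball is isometric (`ball_reachable_and_dist`). There are fewer geodesics altogether, so the load can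
only grow (`trafficLoad_le_ballLoad`), and everything is reduced to an upper bound for the load in
the finite graph, that is, a lower bound for the number of geodesics that stay in the ball. This
rests on two observations.

* A ballot estimate (`ballot_bound`): if `z` is at most half as far from the centre as `u`, and at
  the same distance from `u` as the centre is, then at least half of the geodesics between `z` and
  `u` stays in the ball. Hence the number of geodesics from `u` to `w` in the ball is at least a
  quarter of the sum of `M x * M y` over all `x + y = a + b` such that `x` is close to `a`
  (`cellWeight_le_geoCount_ball`).
* A covering argument in place of concentration estimates: for a given sum `a + b`, the possible `a`
  fall into boundedly many cells such that any two of them in the same cell are close. Within a cell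
  the quotients of `M a * M b` by the sum of `M x * M y` over the cell sum up to one, so all of them
  sum up to at most a constant times the number of tuples `a + b` (`sum_div_cellWeight_le`).
-/

namespace ProductTraffic

/-! ### Counting geodesics in a graph -/

/-- The number of geodesics of `G` from `u` to `w`. It is `1` for `u = w`, and a true count
whenever `G` is locally finite. -/
noncomputable def geoCount {V : Type*} (G : SimpleGraph V) (u w : V) : ℕ :=
  (geodesics G u w).ncard

section General

variable {V : Type*} {G : SimpleGraph V}

/-- A function that vanishes only at `y`, that drops by at most one along an edge, and that can be
lowered along some edge wherever it is nonzero, is the distance to `y`. -/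
theorem reachable_and_dist_eq_of_descent {y : V} {f : V → ℕ} (h0 : f y = 0)
    (hz : ∀ x, f x = 0 → x = y) (hl : ∀ x x', G.Adj x x' → f x ≤ f x' + 1)
    (hd : ∀ x, f x ≠ 0 → ∃ x', G.Adj x x' ∧ f x' + 1 = f x) (x : V) :
    G.Reachable x y ∧ G.dist x y = f x := by
  have hwalk : ∀ n x, f x = n → ∃ p : G.Walk x y, p.length = n := by
    intro n
    induction n with
    | zero => intro x hx; obtain rfl := hz x hx; exact ⟨.nil, rfl⟩
    | succ n ih =>
      intro x hx
      obtain ⟨x', hadj, hx'⟩ := hd x (by omega)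
      obtain ⟨p, hp⟩ := ih x' (by omega)
      exact ⟨.cons hadj p, by simp [hp]⟩
  have hlow : ∀ {x : V} (p : G.Walk x y), f x ≤ p.length := by
    intro x p
    induction p with
    | nil => omega
    | cons h p ih =>
      have := hl _ _ h
      have := ih h0 hz hwalk
      simp only [SimpleGraph.Walk.length_cons]
      omega
  obtain ⟨p, hp⟩ := hwalk _ x rfl
  refine ⟨⟨p⟩, le_antisymm (hp ▸ SimpleGraph.dist_le p) ?_⟩
  obtain ⟨p', hp'⟩ := SimpleGraph.Reachable.exists_walk_length_eq_dist ⟨p⟩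
  exact hp' ▸ hlow p'

theorem geodesics_finite [G.LocallyFinite] (u w : V) : (geodesics G u w).Finite := by
  classical exact Set.toFinite {p : G.Walk u w | p.length = G.dist u w}

theorem geoCount_pos [G.LocallyFinite] {u w : V} (h : G.Reachable u w) : 0 < geoCount G u w := by
  obtain ⟨p, hp⟩ := h.exists_walk_length_eq_dist
  exact (Set.ncard_pos (geodesics_finite u w)).2 ⟨p, hp⟩

theorem geoCount_self (u : V) : geoCount G u u = 1 := by
  have : geodesics G u u = {SimpleGraph.Walk.nil} := by
    ext p
    simp [geodesics, SimpleGraph.Walk.length_eq_zero_iff, SimpleGraph.Walk.eq_nil_iff_nil]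
  rw [geoCount, this, Set.ncard_singleton]

theorem geoCount_comm (u w : V) : geoCount G u w = geoCount G w u := by
  refine Set.ncard_congr (fun p _ => p.reverse) ?_ ?_ ?_
  · intro p hp
    simpa [geodesics, SimpleGraph.dist_comm] using hp
  · intro p p' _ _ h
    simpa using congrArg SimpleGraph.Walk.reverse h
  · intro p hp
    exact ⟨p.reverse, by simpa [geodesics, SimpleGraph.dist_comm] using hp, by simp⟩

theorem sum_geoCount_le [G.LocallyFinite] {ι : Type*} [Fintype ι] {z u : V} {e : ι → V}
    (he : Function.Injective e) (hadj : ∀ i, G.Adj z (e i))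
    (hdist : ∀ i, G.dist (e i) u + 1 = G.dist z u) :
    ∑ i, geoCount G (e i) u ≤ geoCount G z u := by
  have := fun a b => (geodesics_finite (G := G) a b).to_subtype
  let F : (Σ i, geodesics G (e i) u) → geodesics G z u := fun x =>
    ⟨.cons (hadj x.1) x.2.1, by
      have := x.2.2
      simp only [geodesics, Set.mem_ofPred_eq] at this ⊢
      rw [SimpleGraph.Walk.length_cons, this, hdist]⟩
  have hF : Function.Injective F := by
    rintro ⟨i, p, hp⟩ ⟨j, p', hp'⟩ h
    simp only [F, Subtype.mk.injEq, SimpleGraph.Walk.cons.injEq] at h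
    obtain ⟨hij, hpp⟩ := h
    obtain rfl := he hij
    simpa using hpp
  have := Nat.card_le_card_of_injective F hF
  rw [Nat.card_sigma] at this
  exact this

theorem sum_geoCount_eq [G.LocallyFinite] {ι : Type*} [Fintype ι] {z u : V} {e : ι → V}
    (he : Function.Injective e) (hadj : ∀ i, G.Adj z (e i))
    (hdist : ∀ i, G.dist (e i) u + 1 = G.dist z u) (hzu : G.dist z u ≠ 0)
    (hsurj : ∀ z', G.Adj z z' → G.dist z' u + 1 = G.dist z u → ∃ i, e i = z') :
    ∑ i, geoCount G (e i) u = geoCount G z u := by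
  refine le_antisymm (sum_geoCount_le he hadj hdist) ?_
  have := fun a b => (geodesics_finite (G := G) a b).to_subtype
  have hsum : ∑ i, geoCount G (e i) u = Nat.card (Σ i, geodesics G (e i) u) := by
    rw [Nat.card_sigma]; rfl
  rw [hsum]
  let F : (Σ i, geodesics G (e i) u) → geodesics G z u := fun x =>
    ⟨.cons (hadj x.1) x.2.1, by
      have := x.2.2
      simp only [geodesics, Set.mem_ofPred_eq] at this ⊢
      rw [SimpleGraph.Walk.length_cons, this, hdist]⟩
  refine Nat.card_le_card_of_surjective F ?_
  rintro ⟨p, hp⟩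
  cases p with
  | nil => simp at hzu
  | cons h p =>
    rename_i z'
    have hp1 : p.length + 1 = G.dist z u := by simpa [geodesics] using hp
    have h1 := SimpleGraph.dist_le p
    have h2 : G.dist z u ≤ G.dist z' u + 1 := by
      obtain ⟨p', hp'⟩ := SimpleGraph.Reachable.exists_walk_length_eq_dist ⟨p⟩
      simpa [hp'] using SimpleGraph.dist_le (SimpleGraph.Walk.cons h p')
    obtain ⟨i, rfl⟩ := hsurj z' h (by omega)
    exact ⟨⟨i, p, by simp only [geodesics, Set.mem_ofPred_eq]; omega⟩, rfl⟩

theorem append_injective_of_length_eq {u v w : V} {p p' : G.Walk u v} {q q' : G.Walk v w}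
    (hl : p.length = p'.length) (h : p.append q = p'.append q') : p = p' ∧ q = q' := by
  have hs := congrArg SimpleGraph.Walk.support h
  rw [SimpleGraph.Walk.support_append, SimpleGraph.Walk.support_append] at hs
  obtain ⟨h1, h2⟩ := List.append_inj hs (by simp [hl])
  refine ⟨SimpleGraph.Walk.ext_support h1, SimpleGraph.Walk.ext_support ?_⟩
  rw [← SimpleGraph.Walk.cons_tail_support q, ← SimpleGraph.Walk.cons_tail_support q', h2]

/-- Geodesics passing through distinct vertices at the same distance from the starting point are
distinct. -/
theorem sum_geoCount_mul_le [G.LocallyFinite] {ι : Type*} [Fintype ι] {u w : V} {e : ι → V}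
    {s : ℕ} (he : Function.Injective e) (hs : ∀ i, G.dist u (e i) = s)
    (hdist : ∀ i, G.dist u (e i) + G.dist (e i) w = G.dist u w) :
    ∑ i, geoCount G u (e i) * geoCount G (e i) w ≤ geoCount G u w := by
  have := fun a b => (geodesics_finite (G := G) a b).to_subtype
  let F : (Σ i, geodesics G u (e i) × geodesics G (e i) w) → geodesics G u w := fun x =>
    ⟨x.2.1.1.append x.2.2.1, by
      have h1 := x.2.1.2
      have h2 := x.2.2.2
      simp only [geodesics, Set.mem_ofPred_eq] at h1 h2 ⊢
      rw [SimpleGraph.Walk.length_append, h1, h2, hdist]⟩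
  have hF : Function.Injective F := by
    rintro ⟨i, ⟨p, hp⟩, q, hq⟩ ⟨j, ⟨p', hp'⟩, q', hq'⟩ h
    simp only [F, Subtype.mk.injEq] at h
    simp only [geodesics, Set.mem_ofPred_eq, hs] at hp hp'
    have hij : e i = e j := by
      have := congrArg (fun p => SimpleGraph.Walk.getVert p s) h
      simpa [SimpleGraph.Walk.getVert_append, hp, hp'] using this
    obtain rfl := he hij
    obtain ⟨rfl, rfl⟩ := append_injective_of_length_eq (by omega) h
    rfl
  have := Nat.card_le_card_of_injective F hF
  rw [Nat.card_sigma] at this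
  simpa [Nat.card_prod, geoCount, Nat.card_coe_set_eq] using this

theorem ncard_geodesics_through [G.LocallyFinite] {u v w : V}
    (h : G.dist u v + G.dist v w = G.dist u w) :
    {p ∈ geodesics G u w | v ∈ p.support}.ncard = geoCount G u v * geoCount G v w := by
  classical
  have hprod : geoCount G u v * geoCount G v w = (geodesics G u v ×ˢ geodesics G v w).ncard := by
    rw [Set.ncard_prod]; rfl
  rw [hprod]
  symm
  refine Set.ncard_congr (fun x _ => x.1.append x.2) ?_ ?_ ?_
  · rintro ⟨p, q⟩ ⟨hp, hq⟩
    simp only [geodesics, Set.mem_ofPred_eq] at hp hq ⊢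
    refine ⟨by rw [SimpleGraph.Walk.length_append, hp, hq, h], ?_⟩
    simp [SimpleGraph.Walk.mem_support_append_iff]
  · rintro ⟨p, q⟩ ⟨p', q'⟩ ⟨hp, _⟩ ⟨hp', _⟩ heq
    simp only [geodesics, Set.mem_ofPred_eq] at hp hp'
    obtain ⟨h1, h2⟩ := append_injective_of_length_eq (hp.trans hp'.symm) heq
    exact Prod.ext h1 h2
  · rintro p ⟨hp, hv⟩
    have hl := congrArg SimpleGraph.Walk.length (p.take_spec hv)
    have h1 := SimpleGraph.dist_le (p.takeUntil v hv)
    have h2 := SimpleGraph.dist_le (p.dropUntil v hv)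
    simp only [geodesics, Set.mem_ofPred_eq] at hp
    rw [SimpleGraph.Walk.length_append] at hl
    refine ⟨(p.takeUntil v hv, p.dropUntil v hv), ⟨?_, ?_⟩, p.take_spec hv⟩ <;>
      simp only [geodesics, Set.mem_ofPred_eq] <;> omega

theorem flowThrough_of_between [G.LocallyFinite] {u v w : V}
    (h : G.dist u v + G.dist v w = G.dist u w) :
    flowThrough G u w v = (geoCount G u v * geoCount G v w : ℝ) / geoCount G u w := by
  rw [flowThrough, ncard_geodesics_through h]
  simp [geoCount]

theorem flowThrough_of_not_between {u v w : V} (hG : G.Connected)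
    (h : G.dist u v + G.dist v w ≠ G.dist u w) : flowThrough G u w v = 0 := by
  classical
  have : {p ∈ geodesics G u w | v ∈ p.support} = ∅ := by
    rw [Set.eq_empty_iff_forall_notMem]
    rintro p ⟨hp, hv⟩
    have hl := congrArg SimpleGraph.Walk.length (p.take_spec hv)
    have h1 := SimpleGraph.dist_le (p.takeUntil v hv)
    have h2 := SimpleGraph.dist_le (p.dropUntil v hv)
    have h3 := hG.dist_triangle (u := u) (v := v) (w := w)
    simp only [geodesics, Set.mem_ofPred_eq] at hp
    rw [SimpleGraph.Walk.length_append] at hl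
    omega
  rw [flowThrough, this]
  simp

theorem flowThrough_nonneg (u w v : V) : 0 ≤ flowThrough G u w v := by
  unfold flowThrough; positivity

/-- Between two vertices of a connected graph there is a vertex at any prescribed distance not
exceeding theirs. -/
theorem exists_dist_eq_of_le (hG : G.Connected) {u w : V} {m n : ℕ} (h : m + n = G.dist u w) :
    ∃ z, G.dist u z = m ∧ G.dist z w = n := by
  obtain ⟨p, hp⟩ := hG.exists_walk_length_eq_dist u w
  have h1 := SimpleGraph.dist_le (p.take m)
  have h2 := SimpleGraph.dist_le (p.drop m)
  have h3 := hG.dist_triangle (u := u) (v := p.getVert m) (w := w)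
  have h4 := p.take_length m
  have h5 := p.drop_length m
  exact ⟨p.getVert m, by omega, by omega⟩

end General

/-! ### Distances and spheres in a regular tree -/

section Tree

variable {V : Type*} {T : SimpleGraph V}

open scoped Classical in
/-- A neighbour of `x` that is closer to `y`; the junk value is `x` if there is none. In a tree it
is unique for `x ≠ y`. -/
noncomputable def toward (T : SimpleGraph V) (x y : V) : V :=
  if h : ∃ x', T.Adj x x' ∧ T.dist x' y + 1 = T.dist x y then h.choose else x

theorem toward_spec (hT : T.Connected) {x y : V} (h : T.dist x y ≠ 0) :
    T.Adj x (toward T x y) ∧ T.dist (toward T x y) y + 1 = T.dist x y := by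
  have hex : ∃ x', T.Adj x x' ∧ T.dist x' y + 1 = T.dist x y := by
    obtain ⟨z, h1, h2⟩ := exists_dist_eq_of_le hT (u := x) (w := y) (m := 1)
      (n := T.dist x y - 1) (by omega)
    exact ⟨z, SimpleGraph.dist_eq_one_iff_adj.1 h1, by omega⟩
  rw [toward, dif_pos hex]
  exact hex.choose_spec

theorem eq_of_closer (hT : T.IsTree) {x y x' x'' : V} (h' : T.Adj x x')
    (hd' : T.dist x' y + 1 = T.dist x y) (h'' : T.Adj x x'')
    (hd'' : T.dist x'' y + 1 = T.dist x y) : x' = x'' := by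
  obtain ⟨p', hp'⟩ := hT.connected.exists_walk_length_eq_dist x' y
  obtain ⟨p'', hp''⟩ := hT.connected.exists_walk_length_eq_dist x'' y
  have h1 := (SimpleGraph.Walk.cons h' p').isPath_of_length_eq_dist (by simp [hp', hd'])
  have h2 := (SimpleGraph.Walk.cons h'' p'').isPath_of_length_eq_dist (by simp [hp'', hd''])
  have := (hT.existsUnique_path x y).unique h1 h2
  exact (SimpleGraph.Walk.cons.inj this).1

theorem toward_eq (hT : T.IsTree) {x y x' : V} (h : T.Adj x x')
    (hd : T.dist x' y + 1 = T.dist x y) : toward T x y = x' :=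
  have hs := toward_spec hT.connected (x := x) (y := y) (by omega)
  eq_of_closer hT hs.1 hs.2 h hd

theorem dist_of_adj_of_ne (hT : T.IsTree) {x y x' x'' : V} (h' : T.Adj x x')
    (hd' : T.dist x' y + 1 = T.dist x y) (h'' : T.Adj x x'') (hne : x'' ≠ x') :
    T.dist x'' y = T.dist x y + 1 := by
  have := hT.dist_eq_dist_add_one_of_adj y h''
  rw [T.dist_comm (u := y), T.dist_comm (u := y)] at this
  rcases this with h | h
  · exact absurd (eq_of_closer hT h'' h.symm h' hd') hne
  · exact h

/-- In a tree, if the edge from `z` towards `u` leads away from `v`, then `z` separates `u`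
from `v`. -/
theorem dist_eq_add_of_turn (hT : T.IsTree) {u v z z' : V} (h : T.Adj z z')
    (hu : T.dist z' u + 1 = T.dist z u) (hv : T.dist z' v = T.dist z v + 1) :
    T.dist u v = T.dist u z + T.dist z v := by
  generalize hn : T.dist z v = n
  induction n generalizing z z' with
  | zero =>
    obtain rfl := hT.connected.dist_eq_zero_iff.1 hn
    simp
  | succ n ih =>
    obtain ⟨h1, h2⟩ := toward_spec hT.connected (x := z) (y := v) (by omega)
    have hne : toward T z v ≠ z' := fun heq => by rw [heq] at h2; omega
    have h3 := dist_of_adj_of_ne hT h hu h1 hne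
    have := ih h1.symm (by omega) (by omega) (by omega)
    rw [this, T.dist_comm (u := u), T.dist_comm (u := u)]
    omega

/-- The vertices at distance `a` from `v` whose geodesic to `v` does not end with the edge from
`q` to `v`. -/
noncomputable def branch (T : SimpleGraph V) [T.LocallyFinite] (v q : V) (a : ℕ) : Finset V :=
  {x ∈ closedBall T v a | T.dist x v = a ∧ T.dist x q = a + 1}

/-- The vertices at distance `a` from `v`. -/
noncomputable def sphere (T : SimpleGraph V) [T.LocallyFinite] (v : V) (a : ℕ) : Finset V :=
  {x ∈ closedBall T v a | T.dist x v = a}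

theorem mem_closedBall_iff_dist [T.LocallyFinite] (hT : T.Connected) {c x : V} {r : ℕ} :
    x ∈ closedBall T c r ↔ T.dist x c ≤ r := by
  rw [mem_closedBall, ← (hT c x).coe_dist_eq_edist, T.dist_comm]
  exact_mod_cast Iff.rfl

theorem mem_branch [T.LocallyFinite] (hT : T.Connected) {v q x : V} {a : ℕ} :
    x ∈ branch T v q a ↔ T.dist x v = a ∧ T.dist x q = a + 1 := by
  rw [branch, Finset.mem_filter, mem_closedBall_iff_dist hT]
  exact ⟨fun h => h.2, fun h => ⟨h.1.le, h⟩⟩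

theorem mem_sphere [T.LocallyFinite] (hT : T.Connected) {v x : V} {a : ℕ} :
    x ∈ sphere T v a ↔ T.dist x v = a := by
  rw [sphere, Finset.mem_filter, mem_closedBall_iff_dist hT]
  exact ⟨fun h => h.2, fun h => ⟨h.le, h⟩⟩

theorem card_branch [T.LocallyFinite] (hT : T.IsTree) {d : ℕ} (hreg : T.IsRegularOfDegree d)
    {v q : V} (h : T.Adj v q) (a : ℕ) : (branch T v q a).card = (d - 1) ^ a := by
  classical
  have hc := hT.connected
  induction a generalizing v q with
  | zero =>
    have : branch T v q 0 = {v} := by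
      ext x
      rw [mem_branch hc, Finset.mem_singleton, hc.dist_eq_zero_iff]
      constructor
      · exact fun h => h.1
      · rintro rfl
        exact ⟨rfl, SimpleGraph.dist_eq_one_iff_adj.2 h⟩
    simp [this]
  | succ a ih =>
    have hU : branch T v q (a + 1)
        = ((T.neighborFinset v).erase q).biUnion fun p => branch T p v a := by
      ext x
      simp only [Finset.mem_biUnion, Finset.mem_erase, SimpleGraph.mem_neighborFinset,
        mem_branch hc]
      rw [T.dist_comm, T.dist_comm (u := x) (v := q)]
      constructor
      · rintro ⟨h1, h2⟩
        obtain ⟨h3, h4⟩ := toward_spec hc (x := v) (y := x) (by omega)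
        refine ⟨toward T v x, ⟨fun heq => ?_, h3⟩, ?_, ?_⟩
        · rw [heq] at h4; omega
        · rw [T.dist_comm]; omega
        · omega
      · rintro ⟨p, ⟨hne, hp⟩, h1, h2⟩
        refine ⟨h2, ?_⟩
        rw [T.dist_comm] at h1
        have := dist_of_adj_of_ne hT (x := v) (y := x) hp (by omega) h hne.symm
        omega
    rw [hU, Finset.card_biUnion]
    · rw [Finset.sum_congr rfl fun p hp => ih
        (SimpleGraph.mem_neighborFinset .. |>.1 (Finset.mem_of_mem_erase hp)).symm]
      rw [Finset.sum_const, Finset.card_erase_of_mem (by simpa using h),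
        SimpleGraph.card_neighborFinset_eq_degree, hreg v, smul_eq_mul, pow_succ']
    · intro p hp p' hp' hne
      rw [Function.onFun, Finset.disjoint_left]
      intro x hx hx'
      rw [mem_branch hc, T.dist_comm, T.dist_comm (u := x) (v := v)] at hx hx'
      simp only [Finset.mem_coe, Finset.mem_erase, SimpleGraph.mem_neighborFinset] at hp hp'
      exact hne (eq_of_closer hT (y := x) hp.2 (by omega) hp'.2 (by omega))

theorem exists_adj_of_regular [T.LocallyFinite] {d : ℕ} (hd : 3 ≤ d)
    (hreg : T.IsRegularOfDegree d) (v : V) : ∃ q, T.Adj v q := by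
  have : 0 < T.degree v := by rw [hreg v]; omega
  exact (SimpleGraph.degree_pos_iff_exists_adj ..).1 this

theorem card_sphere_le [T.LocallyFinite] (hT : T.IsTree) {d : ℕ} (hd : 3 ≤ d)
    (hreg : T.IsRegularOfDegree d) (v : V) (a : ℕ) :
    (sphere T v a).card ≤ 2 * (d - 1) ^ a := by
  classical
  obtain ⟨q, hq⟩ := exists_adj_of_regular hd hreg v
  have hc := hT.connected
  have hsub : sphere T v a ⊆ branch T v q a ∪ branch T q v (a - 1) := by
    intro x hx
    rw [mem_sphere hc] at hx
    rw [Finset.mem_union, mem_branch hc, mem_branch hc]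
    have := hT.dist_eq_dist_add_one_of_adj x hq
    omega
  refine (Finset.card_le_card hsub).trans ((Finset.card_union_le _ _).trans ?_)
  rw [card_branch hT hreg hq, card_branch hT hreg hq.symm]
  have : (d - 1) ^ (a - 1) ≤ (d - 1) ^ a := Nat.pow_le_pow_right (by omega) (by omega)
  omega

theorem le_card_sphere [T.LocallyFinite] (hT : T.IsTree) {d : ℕ} (hd : 3 ≤ d)
    (hreg : T.IsRegularOfDegree d) (v : V) (a : ℕ) :
    (d - 1) ^ a ≤ (sphere T v a).card := by
  obtain ⟨q, hq⟩ := exists_adj_of_regular hd hreg v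
  rw [← card_branch hT hreg hq a]
  refine Finset.card_le_card fun x hx => ?_
  rw [mem_branch hT.connected] at hx
  exact (mem_sphere hT.connected).2 hx.1

/-- The vertices at distance `b` from `v` in the branch at `v` that starts with the edge to `q`,
with `v` itself standing for the vertex at distance `0`. -/
noncomputable def coBranch (T : SimpleGraph V) [T.LocallyFinite] (v q : V) (b : ℕ) : Finset V :=
  if b = 0 then {v} else branch T q v (b - 1)

theorem pow_le_card_coBranch [T.LocallyFinite] (hT : T.IsTree) {d : ℕ} (hd : 3 ≤ d)
    (hreg : T.IsRegularOfDegree d) {v q : V} (h : T.Adj v q) (b : ℕ) :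
    (d - 1) ^ b ≤ (d - 1) * (coBranch T v q b).card := by
  unfold coBranch
  split_ifs with hb
  · simp [hb]; omega
  · rw [card_branch hT hreg h.symm, ← pow_succ', Nat.sub_add_cancel (by omega)]

theorem dist_of_mem_coBranch [T.LocallyFinite] (hT : T.IsTree) {v q y : V} {b : ℕ}
    (hy : y ∈ coBranch T v q b) : T.dist y v = b := by
  unfold coBranch at hy
  split_ifs at hy with hb
  · rw [Finset.mem_singleton] at hy
    simp [hy, hb]
  · rw [mem_branch hT.connected] at hy
    omega

theorem dist_branch_coBranch [T.LocallyFinite] (hT : T.IsTree) {v q x y : V} {a b : ℕ}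
    (h : T.Adj v q) (hx : x ∈ branch T v q a) (hy : y ∈ coBranch T v q b) :
    T.dist x y = T.dist x v + T.dist v y := by
  unfold coBranch at hy
  split_ifs at hy with hb
  · rw [Finset.mem_singleton] at hy
    simp [hy]
  · rw [mem_branch hT.connected] at hx hy
    have := dist_eq_add_of_turn hT (u := y) (v := x) h
      (by rw [T.dist_comm, hy.1, T.dist_comm, hy.2])
      (by rw [T.dist_comm, hx.2, T.dist_comm, hx.1])
    rw [T.dist_comm, this, T.dist_comm (u := v) (v := x), T.dist_comm (u := v) (v := y)]
    omega

end Tree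

/-! ### Multinomial coefficients -/

/-- The multinomial coefficient of a tuple of natural numbers. -/
noncomputable def multi {k : ℕ} (x : Fin k → ℕ) : ℕ := Nat.multinomial Finset.univ x

theorem multi_pos {k : ℕ} (x : Fin k → ℕ) : 0 < multi x := Nat.multinomial_pos _ _

theorem sum_update_pred {k : ℕ} {x : Fin k → ℕ} {i : Fin k} (h : x i ≠ 0) :
    ∑ j, Function.update x i (x i - 1) j + 1 = ∑ j, x j := by
  rw [Finset.sum_update_of_mem (Finset.mem_univ i), ← Finset.sum_erase_add _ _ (Finset.mem_univ i),
    Finset.sdiff_singleton_eq_erase]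
  omega

theorem multi_update_pred {k : ℕ} {x : Fin k → ℕ} {i : Fin k} (h : x i ≠ 0) :
    (∑ j, x j) * multi (Function.update x i (x i - 1)) = multi x * x i := by
  have h1 := Nat.multinomial_spec Finset.univ x
  have h2 := Nat.multinomial_spec Finset.univ (Function.update x i (x i - 1))
  have h3 := sum_update_pred h
  have h4 : ∏ j, (x j).factorial
      = x i * ∏ j, (Function.update x i (x i - 1) j).factorial := by
    rw [← Finset.mul_prod_erase _ _ (Finset.mem_univ i),
      ← Finset.mul_prod_erase Finset.univ
        (fun j => (Function.update x i (x i - 1) j).factorial) (Finset.mem_univ i),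
      ← mul_assoc, Function.update_self, Nat.mul_factorial_pred h]
    congr 1
    refine Finset.prod_congr rfl fun j hj => ?_
    rw [Function.update_of_ne (Finset.ne_of_mem_erase hj)]
  set P := ∏ j, (Function.update x i (x i - 1) j).factorial
  have hP : 0 < P := Finset.prod_pos fun j _ => Nat.factorial_pos _
  rw [h4, ← h3, Nat.factorial_succ, ← h2, h3] at h1
  unfold multi
  refine Nat.eq_of_mul_eq_mul_left hP ?_
  linarith

theorem sum_subtype_ne_zero {ι M : Type*} [Fintype ι] [DecidableEq ι] [AddCommMonoid M]
    (x : ι → ℕ) (F : ι → M) (hF : ∀ i, x i = 0 → F i = 0) :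
    ∑ i : {i // x i ≠ 0}, F i = ∑ i, F i := by
  rw [← Finset.sum_subtype (Finset.univ.filter fun i => x i ≠ 0) (by simp) F]
  exact Finset.sum_filter_of_ne fun i _ h hx => h (hF i hx)

theorem sum_multi_update_pred {k : ℕ} {x : Fin k → ℕ} (h : ∑ j, x j ≠ 0) :
    ∑ i : {i // x i ≠ 0}, multi (Function.update x i (x i - 1)) = multi x := by
  refine Nat.eq_of_mul_eq_mul_left (Nat.pos_of_ne_zero h) ?_
  rw [Finset.mul_sum, Finset.sum_congr rfl fun (i : {i // x i ≠ 0}) _ => multi_update_pred i.2,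
    sum_subtype_ne_zero x (fun i => multi x * x i) fun i hi => by simp [hi], ← Finset.mul_sum,
    mul_comm]

/-! ### Geodesics in a power of a tree -/

section Power

variable {V : Type*} {T : SimpleGraph V} {k : ℕ}

/-- The tuple of the distances between the components of `x` and of `y`. -/
noncomputable def profile (T : SimpleGraph V) (x y : Fin k → V) : Fin k → ℕ :=
  fun i => T.dist (x i) (y i)

/-- The vertex obtained from `x` by one step towards `y` in the component `i`. -/
noncomputable def move (T : SimpleGraph V) (x y : Fin k → V) (i : Fin k) : Fin k → V :=
  Function.update x i (toward T (x i) (y i))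

theorem profile_comm (x y : Fin k → V) : profile T x y = profile T y x := by
  funext i
  exact T.dist_comm

theorem profile_update (x y : Fin k → V) (i : Fin k) (t : V) :
    profile T (Function.update x i t) y = Function.update (profile T x y) i (T.dist t (y i)) := by
  funext j
  by_cases h : j = i
  · subst h; simp [profile]
  · simp [profile, h]

theorem adj_move (hT : T.Connected) {x y : Fin k → V} {i : Fin k} (h : profile T x y i ≠ 0) :
    (power T k).Adj x (move T x y i) := by
  refine ⟨i, ?_, fun j hj => ?_⟩
  · simpa [move] using (toward_spec hT h).1
  · simp [move, hj]

theorem profile_move (hT : T.Connected) {x y : Fin k → V} {i : Fin k}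
    (h : profile T x y i ≠ 0) :
    profile T (move T x y i) y = Function.update (profile T x y) i (profile T x y i - 1) := by
  rw [move, profile_update]
  congr 1
  have := (toward_spec hT h).2
  simp only [profile]
  omega

theorem sum_profile_update (x y : Fin k → V) (i : Fin k) (t : V) :
    ∑ j, profile T (Function.update x i t) y j + T.dist (x i) (y i)
      = ∑ j, profile T x y j + T.dist t (y i) := by
  rw [profile_update, Finset.sum_update_of_mem (Finset.mem_univ i),
    ← Finset.sum_erase_add Finset.univ (profile T x y) (Finset.mem_univ i),
    Finset.sdiff_singleton_eq_erase]
  simp only [profile]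
  omega

theorem sum_profile_move (hT : T.Connected) {x y : Fin k → V} {i : Fin k}
    (h : profile T x y i ≠ 0) :
    ∑ j, profile T (move T x y i) y j + 1 = ∑ j, profile T x y j := by
  rw [profile_move hT h, sum_update_pred h]

theorem eq_of_sum_profile_eq_zero (hT : T.Connected) {x y : Fin k → V}
    (h : ∑ j, profile T x y j = 0) : x = y := by
  funext i
  exact hT.dist_eq_zero_iff.1 (Finset.sum_eq_zero_iff.1 h i (Finset.mem_univ i))

theorem profile_self (x : Fin k → V) : profile T x x = 0 := by
  funext i
  simp [profile]

theorem eq_update_of_adj {x x' : Fin k → V} (h : (power T k).Adj x x') :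
    ∃ i, T.Adj (x i) (x' i) ∧ x' = Function.update x i (x' i) := by
  obtain ⟨i, hi, hij⟩ := h
  refine ⟨i, hi, ?_⟩
  funext j
  by_cases hj : j = i
  · subst hj; simp
  · simp [hj, hij j hj]

theorem sum_profile_le_of_adj (hT : T.Connected) {x x' : Fin k → V} (y : Fin k → V)
    (h : (power T k).Adj x x') : ∑ j, profile T x y j ≤ ∑ j, profile T x' y j + 1 := by
  obtain ⟨i, hi, hx'⟩ := eq_update_of_adj h
  have h1 := sum_profile_update (T := T) x y i (x' i)
  rw [← hx'] at h1
  have h2 := hT.dist_triangle (u := x i) (v := x' i) (w := y i)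
  rw [SimpleGraph.dist_eq_one_iff_adj.2 hi] at h2
  omega

theorem power_reachable_and_dist (hT : T.Connected) (x y : Fin k → V) :
    (power T k).Reachable x y ∧ (power T k).dist x y = ∑ i, profile T x y i := by
  refine reachable_and_dist_eq_of_descent (f := fun x => ∑ i, profile T x y i) ?_ ?_ ?_ ?_ x
  · simp [profile_self]
  · exact fun x h => eq_of_sum_profile_eq_zero hT h
  · exact fun x x' h => sum_profile_le_of_adj hT y h
  · intro x h
    obtain ⟨i, -, hi⟩ := Finset.exists_ne_zero_of_sum_ne_zero h
    exact ⟨_, adj_move hT hi, sum_profile_move hT hi⟩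

theorem power_dist (hT : T.Connected) (x y : Fin k → V) :
    (power T k).dist x y = ∑ i, profile T x y i := (power_reachable_and_dist hT x y).2

theorem power_connected (hT : T.Connected) : (power T k).Connected :=
  have := hT.nonempty
  ⟨fun x y => (power_reachable_and_dist hT x y).1⟩

theorem move_injective (hT : T.Connected) (x y : Fin k → V) :
    Function.Injective fun i : {i // profile T x y i ≠ 0} => move T x y i := by
  rintro ⟨i, hi⟩ ⟨j, hj⟩ h
  by_contra hne
  have hij : i ≠ j := fun h => hne (Subtype.ext h)
  have := congrFun h i
  simp only [move, Function.update_self, Function.update_of_ne hij] at this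
  exact (toward_spec hT hi).1.ne this.symm

theorem exists_move_eq (hT : T.IsTree) {x x' y : Fin k → V} (h : (power T k).Adj x x')
    (hd : ∑ j, profile T x' y j + 1 = ∑ j, profile T x y j) :
    ∃ i : {i // profile T x y i ≠ 0}, move T x y i = x' := by
  obtain ⟨i, hi, hx'⟩ := eq_update_of_adj h
  have h1 := sum_profile_update (T := T) x y i (x' i)
  rw [← hx'] at h1
  refine ⟨⟨i, by simp only [profile]; omega⟩, ?_⟩
  rw [move, toward_eq hT hi (by dsimp only; omega)]
  exact hx'.symm

/-- A step towards `y` in the component `i` changes the distance to `c` by one, and if it leads away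
from `c`, then `x i` lies between `y i` and `c i`. -/
theorem profile_move_center (hT : T.IsTree) {x y c : Fin k → V} {i : Fin k}
    (h : profile T x y i ≠ 0) :
    ∑ j, profile T (move T x y i) c j + 1 = ∑ j, profile T x c j ∨
    ∑ j, profile T (move T x y i) c j = ∑ j, profile T x c j + 1 ∧
      T.dist (y i) (c i) = T.dist (x i) (y i) + T.dist (x i) (c i) := by
  have h1 := sum_profile_update (T := T) x c i (toward T (x i) (y i))
  obtain ⟨h2, h3⟩ := toward_spec hT.connected h
  have h4 := hT.dist_eq_dist_add_one_of_adj (c i) h2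
  rw [T.dist_comm, T.dist_comm (u := c i) (v := toward T (x i) (y i))] at h4
  rcases h4 with h4 | h4
  · exact Or.inl (by rw [move]; omega)
  · refine Or.inr ⟨by rw [move]; omega, ?_⟩
    rw [dist_eq_add_of_turn hT h2 h3 h4, T.dist_comm (u := y i)]

variable [T.LocallyFinite]

theorem geoCount_power_eq_sum (hT : T.IsTree) {z u : Fin k → V}
    (h : ∑ i, profile T z u i ≠ 0) :
    ∑ i : {i // profile T z u i ≠ 0}, geoCount (power T k) (move T z u i) u
      = geoCount (power T k) z u := by
  have hc := hT.connected
  refine sum_geoCount_eq (move_injective hc z u) (fun i => adj_move hc i.2) (fun i => ?_) ?_ ?_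
  · rw [power_dist hc, power_dist hc, sum_profile_move hc i.2]
  · rwa [power_dist hc]
  · intro z' hz' hd
    rw [power_dist hc, power_dist hc] at hd
    exact exists_move_eq hT hz' hd

/-- A geodesic of the power is a sequence of components to move in, so the geodesics are counted
by multinomial coefficients. -/
theorem geoCount_power (hT : T.IsTree) (z u : Fin k → V) :
    geoCount (power T k) z u = multi (profile T z u) := by
  have hc := hT.connected
  generalize hn : ∑ i, profile T z u i = n
  induction n generalizing z with
  | zero =>
    obtain rfl := eq_of_sum_profile_eq_zero hc hn
    rw [geoCount_self, profile_self, multi]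
    simp [Nat.multinomial]
  | succ n ih =>
    rw [← geoCount_power_eq_sum hT (by omega), ← sum_multi_update_pred (by omega)]
    refine Finset.sum_congr rfl fun i _ => ?_
    have := sum_profile_move hc i.2
    rw [ih _ (by omega), profile_move hc i.2]

/-! ### Geodesics in a ball of a power of a tree -/

theorem mem_power_closedBall (hT : T.Connected) {c x : Fin k → V} {r : ℕ} :
    x ∈ closedBall (power T k) c r ↔ ∑ i, profile T x c i ≤ r := by
  rw [mem_closedBall_iff_dist (power_connected hT), power_dist hT]

/-- The ball is isometrically embedded: from every vertex one can step within the ball towards any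
other one, because if every such step leads away from the centre, then the target is farther from
the centre than the current vertex. -/
theorem ball_reachable_and_dist (hT : T.IsTree) (c : Fin k → V) (r : ℕ)
    (x y : {x // x ∈ closedBall (power T k) c r}) :
    (ballGraph (power T k) c r).Reachable x y ∧
      (ballGraph (power T k) c r).dist x y = ∑ i, profile T x.1 y.1 i := by
  have hc := hT.connected
  refine reachable_and_dist_eq_of_descent (f := fun x => ∑ i, profile T x.1 y.1 i) ?_ ?_ ?_ ?_ x
  · simp [profile_self]
  · exact fun x h => Subtype.ext (eq_of_sum_profile_eq_zero hc h)
  · exact fun x x' h => sum_profile_le_of_adj hc y.1 h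
  · rintro ⟨x, hx⟩ h
    have hx' := (mem_power_closedBall hc).1 hx
    have hy' := (mem_power_closedBall hc).1 y.2
    by_cases hex : ∃ i, profile T x y.1 i ≠ 0 ∧
        ∑ j, profile T (move T x y.1 i) c j + 1 = ∑ j, profile T x c j
    · obtain ⟨i, hi, hi'⟩ := hex
      exact ⟨⟨move T x y.1 i, (mem_power_closedBall hc).2 (by omega)⟩, adj_move hc hi,
        sum_profile_move hc hi⟩
    · -- Every step leads away from the centre, so `x` separates `y` from it in each component.
      push Not at hex
      have hall : ∀ j, profile T y.1 c j = profile T x y.1 j + profile T x c j := by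
        intro j
        by_cases hj : profile T x y.1 j = 0
        · have : x j = y.1 j := hc.dist_eq_zero_iff.1 hj
          rw [hj, zero_add]
          simp only [profile, this]
        · exact ((profile_move_center hT hj).resolve_left (hex j hj)).2
      obtain ⟨i, -, hi⟩ := Finset.exists_ne_zero_of_sum_ne_zero h
      have hsum : ∑ j, profile T y.1 c j = ∑ j, profile T x y.1 j + ∑ j, profile T x c j := by
        rw [← Finset.sum_add_distrib]
        exact Finset.sum_congr rfl fun j _ => hall j
      replace hi : profile T x y.1 i ≠ 0 := hi
      have h1 := ((profile_move_center (c := c) hT hi).resolve_left (hex i hi)).1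
      dsimp only at h
      exact ⟨⟨move T x y.1 i, (mem_power_closedBall hc).2 (by omega)⟩, adj_move hc hi,
        sum_profile_move hc hi⟩

theorem ball_dist (hT : T.IsTree) (c : Fin k → V) (r : ℕ)
    (x y : {x // x ∈ closedBall (power T k) c r}) :
    (ballGraph (power T k) c r).dist x y = ∑ i, profile T x.1 y.1 i :=
  (ball_reachable_and_dist hT c r x y).2

theorem ball_connected (hT : T.IsTree) (c : Fin k → V) (r : ℕ) :
    (ballGraph (power T k) c r).Connected :=
  have : Nonempty {x // x ∈ closedBall (power T k) c r} := ⟨⟨c, center_mem_closedBall _ c r⟩⟩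
  ⟨fun x y => (ball_reachable_and_dist hT c r x y).1⟩

noncomputable instance ballGraphLocallyFinite {V : Type*} (G : SimpleGraph V) [G.LocallyFinite]
    (c : V) (r : ℕ) : (ballGraph G c r).LocallyFinite :=
  fun _ => (Set.toFinite _).fintype

theorem geoCount_ball_le (hT : T.IsTree) (c : Fin k → V) (r : ℕ)
    (x y : {x // x ∈ closedBall (power T k) c r}) :
    geoCount (ballGraph (power T k) c r) x y ≤ geoCount (power T k) x.1 y.1 := by
  let φ : ballGraph (power T k) c r →g power T k := ⟨Subtype.val, fun h => h⟩
  refine Set.ncard_le_ncard_of_injOn (fun p => p.map φ) ?_ ?_ (geodesics_finite _ _)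
  · intro p hp
    simp only [geodesics, Set.mem_ofPred_eq] at hp ⊢
    rw [SimpleGraph.Walk.length_map, hp, ball_dist hT, power_dist hT.connected]
  · intro p _ p' _ h
    exact SimpleGraph.Walk.map_injective_of_injective (f := φ) Subtype.val_injective _ _ h

/-- The ballot estimate: of the geodesics from `z` to `u`, at least the proportion
`(|u| - |z|) / d(z, u)` stays in the ball, where `|x|` is the distance from the centre. As in the
ballot theorem, the linear bound reproduces itself when the geodesics are sorted by their first
step. -/
theorem ballot_bound (hT : T.IsTree) (c : Fin k → V) (r : ℕ)
    (z u : {x // x ∈ closedBall (power T k) c r}) :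
    (geoCount (power T k) z.1 u.1 : ℤ) *
        (∑ i, (profile T u.1 c i : ℤ) - ∑ i, (profile T z.1 c i : ℤ)) ≤
      geoCount (ballGraph (power T k) c r) z u * ∑ i, (profile T z.1 u.1 i : ℤ) := by
  have hc := hT.connected
  generalize hn : ∑ i, profile T z.1 u.1 i = n
  induction n generalizing z with
  | zero =>
    obtain rfl : z = u := Subtype.ext (eq_of_sum_profile_eq_zero hc hn)
    simp [profile_self]
  | succ n ih =>
    have hn' : ∑ i, (profile T z.1 u.1 i : ℤ) = n + 1 := by exact_mod_cast hn
    rw [hn']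
    set Δ : ℤ := ∑ i, (profile T u.1 c i : ℤ) - ∑ i, (profile T z.1 c i : ℤ) with hΔ
    -- Only `Δ > 0` matters, and then one step from `z` towards `u` cannot leave the ball.
    rcases le_or_gt Δ 0 with hneg | hpos
    · exact (mul_nonpos_of_nonneg_of_nonpos (by positivity) hneg).trans (by positivity)
    have hu := (mem_power_closedBall hc).1 u.2
    have hpos' : ∑ i, profile T z.1 c i < ∑ i, profile T u.1 c i := by
      zify; omega
    have hmem : ∀ i : {i // profile T z.1 u.1 i ≠ 0},
        move T z.1 u.1 i ∈ closedBall (power T k) c r := by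
      intro i
      rw [mem_power_closedBall hc]
      have := profile_move_center (c := c) hT i.2
      omega
    have hball : ∑ i : {i // profile T z.1 u.1 i ≠ 0},
        geoCount (ballGraph (power T k) c r) ⟨move T z.1 u.1 i, hmem i⟩ u
          ≤ geoCount (ballGraph (power T k) c r) z u := by
      refine sum_geoCount_le (e := fun i : {i // profile T z.1 u.1 i ≠ 0} =>
        (⟨move T z.1 u.1 i, hmem i⟩ : {x // x ∈ closedBall (power T k) c r})) ?_ ?_ ?_
      · exact fun i j h => move_injective hc _ _ (congrArg Subtype.val h)
      · exact fun i => adj_move hc i.2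
      · intro i
        rw [ball_dist hT, ball_dist hT]
        exact sum_profile_move hc i.2
    -- The inductive step ends by cancelling the factor `n = d(z, u) - 1`, so `n = 0` is apart.
    rcases Nat.eq_zero_or_pos n with rfl | hnpos
    · have hone : geoCount (power T k) z.1 u.1
          ≤ geoCount (ballGraph (power T k) c r) z u := by
        rw [← geoCount_power_eq_sum hT (by omega)]
        refine le_trans (Finset.sum_le_sum fun i _ => ?_) hball
        have h1 := sum_profile_move hc i.2
        have h2 : move T z.1 u.1 i = u.1 := eq_of_sum_profile_eq_zero hc (by omega)
        have h3 : (⟨move T z.1 u.1 i, hmem i⟩ : {x // x ∈ closedBall (power T k) c r}) = u :=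
          Subtype.ext h2
        rw [h3, h2, geoCount_self, geoCount_self]
      have hle : Δ ≤ 1 := by
        have h1 := (power_connected (k := k) hc).dist_triangle (u := u.1) (v := z.1) (w := c)
        rw [power_dist hc, power_dist hc, power_dist hc, profile_comm u.1 z.1, hn] at h1
        zify at h1
        omega
      have : Δ = 1 := by omega
      rw [this]
      push_cast
      linarith [(Int.ofNat_le.2 hone : (geoCount (power T k) z.1 u.1 : ℤ) ≤ _)]
    · set g : ℤ := (geoCount (power T k) z.1 u.1 : ℤ) with hg
      have hterm : ∀ i : {i // profile T z.1 u.1 i ≠ 0},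
          g * (profile T z.1 u.1 i * Δ + (profile T z.1 c i - profile T u.1 c i)) ≤
          (n * (n + 1)) *
            geoCount (ballGraph (power T k) c r) ⟨move T z.1 u.1 i, hmem i⟩ u := by
        intro i
        have h1 := sum_profile_move hc i.2
        have h2 := ih ⟨move T z.1 u.1 i, hmem i⟩ (by dsimp only; omega)
        have h3 : ∑ j, (profile T (move T z.1 u.1 i) u.1 j : ℤ) = n := by
          have : ∑ j, profile T (move T z.1 u.1 i) u.1 j = n := by omega
          exact_mod_cast this
        have h4 : ((n : ℤ) + 1) * geoCount (power T k) (move T z.1 u.1 i) u.1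
            = g * profile T z.1 u.1 i := by
          have := multi_update_pred i.2
          rw [← profile_move hc i.2, hn, ← geoCount_power hT, ← geoCount_power hT] at this
          rw [hg]
          exact_mod_cast this
        dsimp only at h2
        rw [h3] at h2
        -- For a step towards the centre this is the triangle inequality; for a step away from it,
        -- `z i` lies between `u i` and `c i`, and equality holds.
        have h5 : (profile T z.1 c i : ℤ) - profile T u.1 c i ≤ profile T z.1 u.1 i *
            (∑ j, (profile T z.1 c j : ℤ) - ∑ j, (profile T (move T z.1 u.1 i) c j : ℤ)) := by
          rcases profile_move_center (c := c) hT i.2 with h | ⟨h, h'⟩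
          · zify at h
            rw [← h]
            have := hc.dist_triangle (u := z.1 i) (v := u.1 i) (w := c i)
            simp only [profile]
            zify at this
            linarith
          · zify at h
            rw [h]
            simp only [profile]
            zify at h'
            linarith
        calc g * (profile T z.1 u.1 i * Δ + (profile T z.1 c i - profile T u.1 c i))
            ≤ g * (profile T z.1 u.1 i * Δ + profile T z.1 u.1 i *
              (∑ j, (profile T z.1 c j : ℤ)
                - ∑ j, (profile T (move T z.1 u.1 i) c j : ℤ))) := by
              gcongr
          _ = ((n : ℤ) + 1) * (geoCount (power T k) (move T z.1 u.1 i) u.1 *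
              (∑ j, (profile T u.1 c j : ℤ)
                - ∑ j, (profile T (move T z.1 u.1 i) c j : ℤ))) := by
              rw [← mul_assoc, h4, hΔ]; ring
          _ ≤ ((n : ℤ) + 1) * (geoCount (ballGraph (power T k) c r)
                ⟨move T z.1 u.1 i, hmem i⟩ u * n) := by gcongr
          _ = _ := by ring
      have hsum := Finset.sum_le_sum fun i (_ : i ∈ Finset.univ) => hterm i
      rw [sum_subtype_ne_zero (profile T z.1 u.1) (fun i => g * (profile T z.1 u.1 i * Δ +
          ((profile T z.1 c i : ℤ) - profile T u.1 c i))), ← Finset.mul_sum, ← Finset.mul_sum,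
        Finset.sum_add_distrib, ← Finset.sum_mul, hn', Finset.sum_sub_distrib] at hsum
      · have h6 : (∑ i : {i // profile T z.1 u.1 i ≠ 0},
            (geoCount (ballGraph (power T k) c r) ⟨move T z.1 u.1 i, hmem i⟩ u : ℤ))
              ≤ geoCount (ballGraph (power T k) c r) z u := by exact_mod_cast hball
        have h7 : (n : ℤ) * (g * Δ)
            ≤ n * (geoCount (ballGraph (power T k) c r) z u * ((n : ℤ) + 1)) := by
          calc (n : ℤ) * (g * Δ) = g * ((n + 1) * Δ + (∑ i, (profile T z.1 c i : ℤ)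
                - ∑ i, (profile T u.1 c i : ℤ))) := by rw [hΔ]; ring
            _ ≤ _ := hsum
            _ ≤ (n * (n + 1)) * geoCount (ballGraph (power T k) c r) z u := by gcongr
            _ = _ := by ring
        have := le_of_mul_le_mul_left h7 (by exact_mod_cast hnpos)
        exact_mod_cast this
      · intro i hi
        have : z.1 i = u.1 i := hc.dist_eq_zero_iff.1 hi
        simp [profile, this]

/-- No geodesic to the centre leaves the ball. -/
theorem geoCount_ball_center (hT : T.IsTree) (c : Fin k → V) (r : ℕ)
    (u : {x // x ∈ closedBall (power T k) c r}) :
    geoCount (ballGraph (power T k) c r) ⟨c, center_mem_closedBall _ c r⟩ u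
      = geoCount (power T k) c u.1 := by
  refine le_antisymm (geoCount_ball_le hT c r _ _) ?_
  have h := ballot_bound hT c r ⟨c, center_mem_closedBall _ c r⟩ u
  simp only [profile_self, profile_comm u.1 c] at h
  rcases Nat.eq_zero_or_pos (∑ i, profile T c u.1 i) with h0 | h0
  · have hu : (⟨c, center_mem_closedBall _ c r⟩ : {x // x ∈ closedBall (power T k) c r}) = u :=
      Subtype.ext (eq_of_sum_profile_eq_zero hT.connected h0)
    subst hu
    rw [geoCount_self, geoCount_self]
  · have h0' : (0 : ℤ) < ∑ i, (profile T c u.1 i : ℤ) := by exact_mod_cast h0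
    simp only [Pi.zero_apply, Nat.cast_zero, Finset.sum_const_zero, sub_zero] at h
    exact_mod_cast le_of_mul_le_mul_right h h0'

end Power

/-! ### Sums over compositions -/

/-- The `k`-tuples of natural numbers with sum `s`. -/
noncomputable def comps (k s : ℕ) : Finset (Fin k → ℕ) := Finset.piAntidiag Finset.univ s

theorem mem_comps {k s : ℕ} {a : Fin k → ℕ} : a ∈ comps k s ↔ ∑ i, a i = s := by
  simp [comps]

theorem card_comps_le {k : ℕ} (hk : 1 ≤ k) (s : ℕ) : (comps k s).card ≤ (s + 1) ^ (k - 1) := by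
  obtain ⟨m, rfl⟩ : ∃ m, k = m + 1 := ⟨k - 1, by omega⟩
  have hcard : (Fintype.piFinset fun _ : Fin m => Finset.range (s + 1)).card = (s + 1) ^ m := by
    simp
  rw [Nat.add_sub_cancel, ← hcard]
  refine Finset.card_le_card_of_injOn Fin.tail ?_ ?_
  · intro a ha
    rw [Finset.mem_coe, mem_comps, Fin.sum_univ_succ] at ha
    rw [Finset.mem_coe, Fintype.mem_piFinset]
    intro i
    have := Finset.single_le_sum (f := fun i : Fin m => a i.succ) (fun _ _ => Nat.zero_le _)
      (Finset.mem_univ i)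
    rw [Finset.mem_range]
    simp only [Fin.tail] at this ⊢
    omega
  · intro a ha b hb h
    rw [Finset.mem_coe, mem_comps, Fin.sum_univ_succ] at ha hb
    have h1 : ∀ i : Fin m, a i.succ = b i.succ := fun i => congrFun h i
    simp only [h1] at ha
    funext i
    refine Fin.cases ?_ h1 i
    omega

theorem pow_le_card_comps {k : ℕ} (hk : 1 ≤ k) (s : ℕ) :
    s ^ (k - 1) ≤ k ^ (k - 1) * (comps k s).card := by
  obtain ⟨m, rfl⟩ : ∃ m, k = m + 1 := ⟨k - 1, by omega⟩
  rw [Nat.add_sub_cancel]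
  have hcard : (Fintype.piFinset fun _ : Fin m => Finset.range (s / (m + 1) + 1)).card
      = (s / (m + 1) + 1) ^ m := by simp
  have hle : (s / (m + 1) + 1) ^ m ≤ (comps (m + 1) s).card := by
    rw [← hcard]
    -- All components but the first are free in `[0, s / k]`; the first makes up the sum.
    refine Finset.card_le_card_of_injOn
      (fun f => (Fin.cons (s - ∑ i, f i) f : Fin (m + 1) → ℕ)) ?_ ?_
    · intro f hf
      rw [Finset.mem_coe, Fintype.mem_piFinset] at hf
      have h1 : ∑ i, f i ≤ m * (s / (m + 1)) := by
        have := Finset.sum_le_card_nsmul Finset.univ f (s / (m + 1)) fun i _ =>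
          Nat.lt_succ_iff.1 (Finset.mem_range.1 (hf i))
        simpa using this
      have h2 : m * (s / (m + 1)) ≤ s :=
        le_trans (Nat.mul_le_mul_right _ (Nat.le_succ m)) (Nat.mul_div_le s (m + 1))
      rw [Finset.mem_coe, mem_comps, Fin.sum_univ_succ]
      simp only [Fin.cons_zero, Fin.cons_succ]
      omega
    · intro f _ g _ h
      have := congrArg Fin.tail h
      simpa using this
  calc s ^ m ≤ ((m + 1) * (s / (m + 1) + 1)) ^ m :=
        Nat.pow_le_pow_left (Nat.lt_mul_div_succ s (Nat.succ_pos m)).le m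
    _ = (m + 1) ^ m * (s / (m + 1) + 1) ^ m := mul_pow _ _ _
    _ ≤ _ := Nat.mul_le_mul_left _ hle

/-- The Vandermonde identity for multinomial coefficients. -/
theorem sum_multi_mul_multi {k s t : ℕ} {c : Fin k → ℕ} (hc : c ∈ comps k (s + t)) :
    ∑ p ∈ comps k s ×ˢ comps k t with p.1 + p.2 = c, multi p.1 * multi p.2 = multi c := by
  classical
  let F : (Fin k → ℕ) → (Fin k →₀ ℕ) := Finsupp.equivFunOnFinite.symm
  have hF : ∀ a b, F (a + b) = F a + F b := fun a b => by ext; rfl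
  have hinj : Function.Injective F := Finsupp.equivFunOnFinite.symm.injective
  have hpow : ∀ n, (∑ i, MvPolynomial.X i : MvPolynomial (Fin k) ℕ) ^ n
      = ∑ a ∈ comps k n, MvPolynomial.monomial (F a) (multi a) := by
    intro n
    rw [Finset.sum_pow_eq_sum_piAntidiag]
    refine Finset.sum_congr rfl fun a _ => ?_
    rw [MvPolynomial.monomial_eq, Finsupp.prod_fintype _ _ (by simp)]
    simp [multi, F]
  -- Compare the coefficients in `(∑ X) ^ (s + t) = (∑ X) ^ s * (∑ X) ^ t`.
  have h := congrArg (MvPolynomial.coeff (F c))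
    (pow_add (∑ i, MvPolynomial.X i : MvPolynomial (Fin k) ℕ) s t)
  rw [hpow, hpow, hpow, Finset.sum_mul_sum, ← Finset.sum_product', MvPolynomial.coeff_sum,
    MvPolynomial.coeff_sum] at h
  simp only [MvPolynomial.monomial_mul, MvPolynomial.coeff_monomial, ← hF, hinj.eq_iff] at h
  rw [Finset.sum_ite_eq' , if_pos hc] at h
  rw [Finset.sum_filter, h]

theorem sum_multi_mul_multi_div (k s t : ℕ) :
    ∑ p ∈ comps k s ×ˢ comps k t, (multi p.1 * multi p.2 : ℝ) / multi (p.1 + p.2)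
      = (comps k (s + t)).card := by
  have hmaps : ∀ p ∈ comps k s ×ˢ comps k t, p.1 + p.2 ∈ comps k (s + t) := by
    intro p hp
    rw [Finset.mem_product, mem_comps, mem_comps] at hp
    rw [mem_comps, ← hp.1, ← hp.2, ← Finset.sum_add_distrib]
    rfl
  rw [← Finset.sum_fiberwise_of_maps_to hmaps, Finset.cast_card]
  refine Finset.sum_congr rfl fun c hc => ?_
  have h1 : (multi c : ℝ) ≠ 0 := by exact_mod_cast (multi_pos c).ne'
  have h2 := congrArg (Nat.cast (R := ℝ)) (sum_multi_mul_multi hc)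
  push_cast at h2
  rw [Finset.sum_congr rfl fun p hp => by rw [(Finset.mem_filter.1 hp).2], ← Finset.sum_div, h2,
    div_self h1]

/-- Weights that are normalized within each fibre of `κ` sum up to the number of fibres. -/
theorem sum_div_sum_fiber {α β : Type*} [DecidableEq β] (P : Finset α) (κ : α → β) (g : α → ℝ)
    (hg : ∀ p ∈ P, 0 < g p) :
    ∑ p ∈ P, g p / ∑ p' ∈ P with κ p' = κ p, g p' = (P.image κ).card := by
  rw [← Finset.sum_fiberwise_of_maps_to (t := P.image κ) fun p hp => Finset.mem_image_of_mem κ hp,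
    Finset.cast_card]
  refine Finset.sum_congr rfl fun y hy => ?_
  obtain ⟨p, hp, rfl⟩ := Finset.mem_image.1 hy
  have hpos : 0 < ∑ p' ∈ P with κ p' = κ p, g p' :=
    Finset.sum_pos (fun p' hp' => hg p' (Finset.mem_filter.1 hp').1)
      ⟨p, Finset.mem_filter.2 ⟨hp, rfl⟩⟩
  rw [Finset.sum_congr rfl fun p' hp' => by rw [(Finset.mem_filter.1 hp').2], ← Finset.sum_div,
    div_self hpos.ne']

/-- The cell of a composition `a` of `s`: its position rounded to the multiples of `s / (2 k)`.
There are boundedly many cells, and their `ℓ¹`-diameter is at most `s / 2`. For `s = 0` all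
quotients are the junk value `0`, and there is a single cell. -/
def cell {k : ℕ} (s : ℕ) (a : Fin k → ℕ) : Fin k → ℕ := fun i => 2 * k * a i / s

theorem cell_mem {k s : ℕ} {a : Fin k → ℕ} (ha : a ∈ comps k s) :
    cell s a ∈ Fintype.piFinset fun _ : Fin k => Finset.range (2 * k + 1) := by
  rw [Fintype.mem_piFinset]
  intro i
  rw [mem_comps] at ha
  have h1 : a i ≤ s := ha ▸ Finset.single_le_sum (fun _ _ => Nat.zero_le _) (Finset.mem_univ i)
  rw [Finset.mem_range, Nat.lt_succ_iff, cell]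
  exact Nat.div_le_of_le_mul (by rw [mul_comm s]; exact Nat.mul_le_mul_left _ h1)

theorem two_mul_sum_diff_le_of_cell_eq {k s : ℕ} {a x : Fin k → ℕ} (ha : a ∈ comps k s)
    (hx : x ∈ comps k s) (h : cell s x = cell s a) :
    2 * ∑ i, ((x i - a i) + (a i - x i)) ≤ s := by
  rw [mem_comps] at ha hx
  rcases Nat.eq_zero_or_pos s with rfl | hs
  · have ha' := fun i => Finset.sum_eq_zero_iff.1 ha i (Finset.mem_univ i)
    have hx' := fun i => Finset.sum_eq_zero_iff.1 hx i (Finset.mem_univ i)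
    simp [ha', hx']
  rcases Nat.eq_zero_or_pos k with rfl | hk
  · simp
  have hi : ∀ i, 2 * k * ((x i - a i) + (a i - x i)) ≤ s := by
    intro i
    have h1 : 2 * k * x i / s = 2 * k * a i / s := congrFun h i
    have h2 := Nat.div_add_mod (2 * k * x i) s
    have h3 := Nat.div_add_mod (2 * k * a i) s
    have h4 := Nat.mod_lt (2 * k * x i) hs
    have h5 := Nat.mod_lt (2 * k * a i) hs
    rw [h1] at h2
    rw [mul_add, Nat.mul_sub, Nat.mul_sub]
    omega
  have hsum := Finset.sum_le_sum fun i (_ : i ∈ Finset.univ) => hi i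
  rw [← Finset.mul_sum, Finset.sum_const, Finset.card_univ, Fintype.card_fin, smul_eq_mul,
    mul_right_comm] at hsum
  refine Nat.le_of_mul_le_mul_left ?_ hk
  linarith

/-- The cell of a pair of compositions: their sum and their cells. -/
def pairCell {k : ℕ} (s t : ℕ) (p : (Fin k → ℕ) × (Fin k → ℕ)) :
    (Fin k → ℕ) × (Fin k → ℕ) × (Fin k → ℕ) :=
  (p.1 + p.2, cell s p.1, cell t p.2)

/-- The sum of the weights `multi x * multi y` over the pairs `(x, y)` in the cell of `p`. -/
noncomputable def cellWeight {k : ℕ} (s t : ℕ) (p : (Fin k → ℕ) × (Fin k → ℕ)) : ℝ :=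
  ∑ p' ∈ comps k s ×ˢ comps k t with pairCell s t p' = pairCell s t p,
    (multi p'.1 * multi p'.2 : ℝ)

theorem sum_div_cellWeight_le (k s t : ℕ) :
    ∑ p ∈ comps k s ×ˢ comps k t, (multi p.1 * multi p.2 : ℝ) / cellWeight s t p
      ≤ (comps k (s + t)).card * ((2 * k + 1) ^ k * (2 * k + 1) ^ k) := by
  have h := sum_div_sum_fiber (comps k s ×ˢ comps k t) (pairCell s t)
    (fun p => (multi p.1 * multi p.2 : ℝ)) fun p _ => by
      have h1 := multi_pos p.1
      have h2 := multi_pos p.2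
      positivity
  unfold cellWeight
  rw [h]
  have hsub : (comps k s ×ˢ comps k t).image (pairCell s t) ⊆
      comps k (s + t) ×ˢ (Fintype.piFinset fun _ : Fin k => Finset.range (2 * k + 1)) ×ˢ
        (Fintype.piFinset fun _ : Fin k => Finset.range (2 * k + 1)) := by
    intro y hy
    obtain ⟨p, hp, rfl⟩ := Finset.mem_image.1 hy
    rw [Finset.mem_product] at hp
    refine Finset.mem_product.2 ⟨?_, Finset.mem_product.2 ⟨cell_mem hp.1, cell_mem hp.2⟩⟩
    rw [mem_comps] at hp ⊢
    rw [mem_comps] at hp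
    simp [pairCell, Finset.sum_add_distrib, hp.1, hp.2]
  have hcard := Finset.card_le_card hsub
  rw [Finset.card_product, Finset.card_product, Fintype.card_piFinset] at hcard
  simp only [Finset.card_range, Finset.prod_const, Finset.card_univ, Fintype.card_fin] at hcard
  exact_mod_cast hcard

/-! ### Flow through the centre -/

section Flow

variable {V : Type*} {T : SimpleGraph V} {k : ℕ}

theorem profile_add_of_between (hT : T.Connected) {u v w : Fin k → V}
    (h : ∑ i, profile T u v i + ∑ i, profile T v w i = ∑ i, profile T u w i) :
    profile T u w = profile T u v + profile T v w := by
  have hle : ∀ i ∈ Finset.univ, profile T u w i ≤ profile T u v i + profile T v w i :=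
    fun i _ => hT.dist_triangle
  rw [← Finset.sum_add_distrib] at h
  funext i
  exact (Finset.sum_eq_sum_iff_of_le hle).1 h.symm i (Finset.mem_univ i)

/-- If `v` is between `u` and `w`, then a vertex at prescribed distances from the components of `u`
and `w` can be chosen on the geodesics through the components of `v`. -/
theorem exists_profile_eq (hT : T.Connected) {u v w : Fin k → V} {x y : Fin k → ℕ}
    (h : profile T u w = profile T u v + profile T v w) (hxy : x + y = profile T u w) :
    ∃ z : Fin k → V, profile T u z = x ∧ profile T z w = y ∧ ∀ i, profile T z v i ≤
      (x i - profile T u v i) + (profile T u v i - x i) := by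
  have hi : ∀ i, ∃ z, T.dist (u i) z = x i ∧ T.dist z (w i) = y i ∧ T.dist z (v i) ≤
      (x i - profile T u v i) + (profile T u v i - x i) := by
    intro i
    have h1 : T.dist (u i) (w i) = T.dist (u i) (v i) + T.dist (v i) (w i) := congrFun h i
    have h2 : x i + y i = T.dist (u i) (w i) := congrFun hxy i
    simp only [profile]
    rcases le_total (x i) (T.dist (u i) (v i)) with hle | hle
    · obtain ⟨z, hz1, hz2⟩ := exists_dist_eq_of_le hT (u := u i) (w := v i) (m := x i)
        (n := T.dist (u i) (v i) - x i) (by omega)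
      have h3 := hT.dist_triangle (u := z) (v := v i) (w := w i)
      have h4 := hT.dist_triangle (u := u i) (v := z) (w := w i)
      exact ⟨z, hz1, by omega, by omega⟩
    · obtain ⟨z, hz1, hz2⟩ := exists_dist_eq_of_le hT (u := v i) (w := w i)
        (m := x i - T.dist (u i) (v i)) (n := y i) (by omega)
      have h3 := hT.dist_triangle (u := u i) (v := v i) (w := z)
      have h4 := hT.dist_triangle (u := u i) (v := z) (w := w i)
      rw [T.dist_comm] at hz1
      rw [T.dist_comm (u := v i)] at h3
      exact ⟨z, by omega, by omega, by omega⟩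
  choose z hz using hi
  exact ⟨z, funext fun i => (hz i).1, funext fun i => (hz i).2.1, fun i => (hz i).2.2⟩

variable [T.LocallyFinite]

/-- If `z` is at most half as far from the centre as `u`, then at least half of the geodesics from
`z` to `u` stays in the ball, provided that their length is the distance of `u` from the centre. -/
theorem geoCount_le_two_mul_ball (hT : T.IsTree) (c : Fin k → V) (r : ℕ)
    (z u : {x // x ∈ closedBall (power T k) c r})
    (hz : 2 * ∑ i, profile T z.1 c i ≤ ∑ i, profile T u.1 c i)
    (hu : ∑ i, profile T z.1 u.1 i = ∑ i, profile T u.1 c i) :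
    geoCount (power T k) z.1 u.1 ≤ 2 * geoCount (ballGraph (power T k) c r) z u := by
  rcases Nat.eq_zero_or_pos (∑ i, profile T u.1 c i) with h0 | h0
  · obtain rfl : z = u := Subtype.ext (eq_of_sum_profile_eq_zero hT.connected (hu.trans h0))
    rw [geoCount_self, geoCount_self]
    omega
  · have h := ballot_bound hT c r z u
    have hu' : ∑ i, (profile T z.1 u.1 i : ℤ) = ∑ i, (profile T u.1 c i : ℤ) := by
      exact_mod_cast hu
    zify at hz h0 ⊢
    rw [hu'] at h
    refine le_of_mul_le_mul_right ?_ h0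
    have hg : (0 : ℤ) ≤ geoCount (power T k) z.1 u.1 := by positivity
    nlinarith

/-- Every pair `(x, y)` in the cell of the pair of profiles of `u` and `w` is realized by a vertex
`z` between `u` and `w` that is at most half as far from the centre as both of them; by the ballot
estimate, a quarter of the geodesics through `z` stays in the ball. -/
theorem cellWeight_le_geoCount_ball (hT : T.IsTree) (c : Fin k → V) (r : ℕ)
    (u w : {x // x ∈ closedBall (power T k) c r})
    (h : profile T u.1 w.1 = profile T u.1 c + profile T c w.1) :
    cellWeight (∑ i, profile T u.1 c i) (∑ i, profile T w.1 c i)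
      (profile T u.1 c, profile T w.1 c) ≤ 4 * geoCount (ballGraph (power T k) c r) u w := by
  classical
  have hc := hT.connected
  set s := ∑ i, profile T u.1 c i with hs
  set t := ∑ i, profile T w.1 c i with ht
  have hsr : s ≤ r := (mem_power_closedBall hc).1 u.2
  set P := {p' ∈ comps k s ×ˢ comps k t |
    pairCell s t p' = pairCell s t (profile T u.1 c, profile T w.1 c)} with hP
  have hz : ∀ p : {p // p ∈ P}, ∃ z : Fin k → V, profile T u.1 z = p.1.1 ∧
      profile T z w.1 = p.1.2 ∧ 2 * ∑ i, profile T z c i ≤ s ∧ 2 * ∑ i, profile T z c i ≤ t := by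
    rintro ⟨⟨x, y⟩, hp⟩
    rw [hP, Finset.mem_filter, Finset.mem_product] at hp
    obtain ⟨⟨hx, hy⟩, heq⟩ := hp
    simp only [pairCell, Prod.mk.injEq] at heq
    obtain ⟨hxy, hcx, hcy⟩ := heq
    dsimp only at hx hy
    obtain ⟨z, h1, h2, h3⟩ := exists_profile_eq hc h
      (x := x) (y := y) (by rw [hxy, h, profile_comm c])
    have h4 := two_mul_sum_diff_le_of_cell_eq (mem_comps.2 hs.symm) hx hcx
    have h5 := two_mul_sum_diff_le_of_cell_eq (mem_comps.2 ht.symm) hy hcy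
    have h6 : ∑ i, profile T z c i
        ≤ ∑ i, ((x i - profile T u.1 c i) + (profile T u.1 c i - x i)) :=
      Finset.sum_le_sum fun i _ => h3 i
    -- Since `x + y` is the sum of the profiles, `x` and `y` deviate from them by the same amount, so
    -- that `z` is close to the centre on the scale of both `s` and `t`.
    have h7 : ∑ i, ((x i - profile T u.1 c i) + (profile T u.1 c i - x i))
        = ∑ i, ((y i - profile T w.1 c i) + (profile T w.1 c i - y i)) := by
      refine Finset.sum_congr rfl fun i _ => ?_
      have : x i + y i = profile T u.1 c i + profile T w.1 c i := congrFun hxy i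
      omega
    exact ⟨z, h1, h2, by omega, by omega⟩
  choose z hz1 hz2 hz3 hz4 using hz
  have hmem : ∀ p, z p ∈ closedBall (power T k) c r := fun p => by
    rw [mem_power_closedBall hc]
    have := hz3 p
    omega
  let e : {p // p ∈ P} → {x // x ∈ closedBall (power T k) c r} := fun p => ⟨z p, hmem p⟩
  have hcomp : ∀ p : {p // p ∈ P}, ∑ i, p.1.1 i = s ∧ ∑ i, p.1.2 i = t := fun p => by
    have := (Finset.mem_filter.1 p.2).1
    rwa [Finset.mem_product, mem_comps, mem_comps] at this
  have hsum := sum_geoCount_mul_le (G := ballGraph (power T k) c r) (u := u) (w := w) (e := e)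
    (s := s) ?_ ?_ ?_
  · have hterm : ∀ p : {p // p ∈ P}, multi p.1.1 * multi p.1.2 ≤
        4 * (geoCount (ballGraph (power T k) c r) u (e p) *
          geoCount (ballGraph (power T k) c r) (e p) w) := by
      intro p
      have h1 := geoCount_le_two_mul_ball hT c r (e p) u (hz3 p) (by
        rw [profile_comm (e p).1, hz1, (hcomp p).1])
      have h2 := geoCount_le_two_mul_ball hT c r (e p) w (hz4 p) (by
        rw [hz2, (hcomp p).2])
      rw [geoCount_power hT] at h1 h2
      rw [profile_comm (e p).1, hz1] at h1
      rw [hz2] at h2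
      rw [geoCount_comm u]
      calc _ ≤ _ := Nat.mul_le_mul h1 h2
        _ = _ := by ring
    have htot : ∑ p ∈ P, multi p.1 * multi p.2 ≤ 4 * geoCount (ballGraph (power T k) c r) u w := by
      rw [← Finset.sum_coe_sort P (fun p => multi p.1 * multi p.2)]
      refine (Finset.sum_le_sum fun p _ => hterm p).trans ?_
      rw [← Finset.mul_sum]
      exact Nat.mul_le_mul_left _ hsum
    have heq : cellWeight s t (profile T u.1 c, profile T w.1 c)
        = ((∑ p ∈ P, multi p.1 * multi p.2 : ℕ) : ℝ) := by
      rw [cellWeight, hP]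
      push_cast
      congr!
    rw [heq]
    exact_mod_cast htot
  · intro p p' hpp
    have hzz : z p = z p' := congrArg Subtype.val hpp
    refine Subtype.ext (Prod.ext ?_ ?_)
    · rw [← hz1, ← hz1, hzz]
    · rw [← hz2, ← hz2, hzz]
  · intro p
    rw [ball_dist hT, hz1, (hcomp p).1]
  · intro p
    rw [ball_dist hT, ball_dist hT, ball_dist hT, hz1, hz2, (hcomp p).1, (hcomp p).2, h, hs, ht,
      profile_comm c, ← Finset.sum_add_distrib]
    rfl

theorem cellWeight_nonneg (s t : ℕ) (p : (Fin k → ℕ) × (Fin k → ℕ)) : 0 ≤ cellWeight s t p :=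
  Finset.sum_nonneg fun _ _ => by positivity

theorem cellWeight_pos {s t : ℕ} {p : (Fin k → ℕ) × (Fin k → ℕ)}
    (hp : p ∈ comps k s ×ˢ comps k t) : 0 < cellWeight s t p := by
  refine Finset.sum_pos (fun p' _ => ?_) ⟨p, Finset.mem_filter.2 ⟨hp, rfl⟩⟩
  have h1 := multi_pos p'.1
  have h2 := multi_pos p'.2
  positivity

theorem flowThrough_ball_le (hT : T.IsTree) (c : Fin k → V) (r : ℕ)
    (u w : {x // x ∈ closedBall (power T k) c r}) :
    flowThrough (ballGraph (power T k) c r) u w ⟨c, center_mem_closedBall _ c r⟩ ≤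
      4 * ((multi (profile T u.1 c) * multi (profile T w.1 c) : ℝ) /
        cellWeight (∑ i, profile T u.1 c i) (∑ i, profile T w.1 c i)
          (profile T u.1 c, profile T w.1 c)) := by
  have hc := hT.connected
  by_cases h : (ballGraph (power T k) c r).dist u ⟨c, center_mem_closedBall _ c r⟩ +
      (ballGraph (power T k) c r).dist ⟨c, center_mem_closedBall _ c r⟩ w
      = (ballGraph (power T k) c r).dist u w
  · rw [flowThrough_of_between h]
    rw [ball_dist hT, ball_dist hT, ball_dist hT] at h
    have hadd := profile_add_of_between hc h
    have h1 := cellWeight_le_geoCount_ball hT c r u w hadd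
    have h2 : 0 < cellWeight (∑ i, profile T u.1 c i) (∑ i, profile T w.1 c i)
        (profile T u.1 c, profile T w.1 c) :=
      cellWeight_pos (Finset.mem_product.2 ⟨mem_comps.2 rfl, mem_comps.2 rfl⟩)
    have h3 : (geoCount (ballGraph (power T k) c r) u ⟨c, center_mem_closedBall _ c r⟩ : ℝ)
        = multi (profile T u.1 c) := by
      rw [geoCount_comm, geoCount_ball_center hT, geoCount_power hT, profile_comm]
    have h4 : (geoCount (ballGraph (power T k) c r) ⟨c, center_mem_closedBall _ c r⟩ w : ℝ)
        = multi (profile T w.1 c) := by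
      rw [geoCount_ball_center hT, geoCount_power hT, profile_comm]
    rw [h3, h4]
    have h5 : (0 : ℝ) < geoCount (ballGraph (power T k) c r) u w := by linarith
    rw [← mul_div_assoc, div_le_div_iff₀ h5 h2]
    have h6 : (0 : ℝ) ≤ multi (profile T u.1 c) * multi (profile T w.1 c) := by positivity
    calc _ ≤ _ := mul_le_mul_of_nonneg_left h1 h6
      _ = _ := by ring
  · rw [flowThrough_of_not_between (ball_connected hT c r) h]
    exact mul_nonneg (by norm_num) (div_nonneg (by positivity) (cellWeight_nonneg _ _ _))

theorem flowThrough_le_ball (hT : T.IsTree) (c : Fin k → V) (r : ℕ)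
    (u w : {x // x ∈ closedBall (power T k) c r}) :
    flowThrough (power T k) u.1 w.1 c ≤
      flowThrough (ballGraph (power T k) c r) u w ⟨c, center_mem_closedBall _ c r⟩ := by
  have hc := hT.connected
  by_cases h : (power T k).dist u.1 c + (power T k).dist c w.1 = (power T k).dist u.1 w.1
  · have h' : (ballGraph (power T k) c r).dist u ⟨c, center_mem_closedBall _ c r⟩ +
        (ballGraph (power T k) c r).dist ⟨c, center_mem_closedBall _ c r⟩ w
        = (ballGraph (power T k) c r).dist u w := by
      rw [power_dist hc, power_dist hc, power_dist hc] at h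
      rw [ball_dist hT, ball_dist hT, ball_dist hT, h]
    rw [flowThrough_of_between h, flowThrough_of_between h', geoCount_ball_center hT,
      geoCount_comm u, geoCount_ball_center hT, geoCount_comm c u.1]
    have h1 : (0 : ℝ) < geoCount (ballGraph (power T k) c r) u w := by
      exact_mod_cast geoCount_pos (ball_reachable_and_dist hT c r u w).1
    have h2 : (geoCount (ballGraph (power T k) c r) u w : ℝ) ≤ geoCount (power T k) u.1 w.1 := by
      exact_mod_cast geoCount_ball_le hT c r u w
    exact div_le_div_of_nonneg_left (by positivity) h1 h2
  · rw [flowThrough_of_not_between (power_connected hc) h]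
    exact flowThrough_nonneg _ _ _

theorem sum_offDiag_subtype {α : Type*} [DecidableEq α] (S : Finset α) (f : α → α → ℝ) :
    ∑ p ∈ (Finset.univ : Finset {x // x ∈ S}).offDiag, f p.1.1 p.2.1
      = ∑ p ∈ S.offDiag, f p.1 p.2 := by
  refine Finset.sum_bij (fun p _ => (p.1.1, p.2.1)) ?_ ?_ ?_ ?_
  · rintro ⟨x, y⟩ h
    exact Finset.mem_offDiag.2 ⟨x.2, y.2, fun hxy => (Finset.mem_offDiag.1 h).2.2 (Subtype.ext hxy)⟩
  · rintro ⟨x, y⟩ _ ⟨x', y'⟩ _ h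
    exact Prod.ext (Subtype.ext (congrArg Prod.fst h)) (Subtype.ext (congrArg Prod.snd h))
  · rintro ⟨x, y⟩ h
    rw [Finset.mem_offDiag] at h
    exact ⟨(⟨x, h.1⟩, ⟨y, h.2.1⟩), by simpa [Finset.mem_offDiag] using h.2.2, rfl⟩
  · intros; rfl

theorem trafficLoad_le_ballLoad (hT : T.IsTree) (c : Fin k → V) (r : ℕ) :
    trafficLoad (power T k) (closedBall (power T k) c r) c ≤ ballLoad (power T k) c r := by
  classical
  unfold ballLoad trafficLoad
  have h := sum_offDiag_subtype (closedBall (power T k) c r)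
    (fun u w => flowThrough (power T k) u w c)
  refine mul_le_mul_of_nonneg_left ?_ (by norm_num)
  calc _ = _ := by convert h.symm
    _ ≤ ∑ p ∈ (Finset.univ : Finset {x // x ∈ closedBall (power T k) c r}).offDiag,
        flowThrough (ballGraph (power T k) c r) p.1 p.2 ⟨c, center_mem_closedBall _ c r⟩ :=
      Finset.sum_le_sum fun p _ => flowThrough_le_ball hT c r p.1 p.2
    _ = _ := by congr!

/-! ### Bounds for the load in terms of compositions -/

/-- A sum over the ball of a function of the distances to the components of the centre, bounded by
a sum over compositions: at most `2 ^ k * (d - 1) ^ s` vertices share a profile with sum `s`. -/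
theorem sum_closedBall_profile_le (hT : T.IsTree) {d : ℕ} (hd : 3 ≤ d)
    (hreg : T.IsRegularOfDegree d) (c : Fin k → V) (r : ℕ) (F : (Fin k → ℕ) → ℝ)
    (hF : ∀ a, 0 ≤ F a) :
    ∑ x ∈ closedBall (power T k) c r, F (profile T x c) ≤
      ∑ s ∈ Finset.range (r + 1), 2 ^ k * ((d - 1 : ℕ) : ℝ) ^ s * ∑ a ∈ comps k s, F a := by
  classical
  have hc := hT.connected
  rw [← Finset.sum_fiberwise_of_maps_to (t := Finset.range (r + 1))
    (g := fun x => ∑ i, profile T x c i) fun x hx =>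
      Finset.mem_range.2 (Nat.lt_succ_of_le ((mem_power_closedBall hc).1 hx))]
  refine Finset.sum_le_sum fun s _ => ?_
  rw [← Finset.sum_fiberwise_of_maps_to (t := comps k s) (g := fun x => profile T x c) fun x hx =>
    mem_comps.2 (Finset.mem_filter.1 hx).2, Finset.mul_sum]
  refine Finset.sum_le_sum fun a ha => ?_
  rw [Finset.sum_congr rfl fun x hx => by rw [(Finset.mem_filter.1 hx).2], Finset.sum_const,
    nsmul_eq_mul]
  refine mul_le_mul_of_nonneg_right ?_ (hF a)
  have hsub : {x ∈ {x ∈ closedBall (power T k) c r | ∑ i, profile T x c i = s} |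
      profile T x c = a} ⊆ Fintype.piFinset fun i => sphere T (c i) (a i) := by
    intro x hx
    rw [Finset.mem_filter] at hx
    rw [Fintype.mem_piFinset]
    intro i
    rw [mem_sphere hc, ← hx.2]
    rfl
  have hcard := Finset.card_le_card hsub
  rw [Fintype.card_piFinset] at hcard
  have hprod : ∏ i, (sphere T (c i) (a i)).card ≤ ∏ i, (2 * (d - 1) ^ a i) :=
    Finset.prod_le_prod' fun i _ => card_sphere_le hT hd hreg (c i) (a i)
  rw [Finset.prod_mul_distrib, Finset.prod_pow_eq_pow_sum, mem_comps.1 ha, Finset.prod_const,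
    Finset.card_univ, Fintype.card_fin] at hprod
  exact_mod_cast hcard.trans hprod

theorem card_closedBall_le (hT : T.IsTree) {d : ℕ} (hd : 3 ≤ d)
    (hreg : T.IsRegularOfDegree d) (c : Fin k → V) (r : ℕ) :
    ((closedBall (power T k) c r).card : ℝ) ≤
      ∑ s ∈ Finset.range (r + 1), 2 ^ k * ((d - 1 : ℕ) : ℝ) ^ s * (comps k s).card := by
  have := sum_closedBall_profile_le hT hd hreg c r (fun _ => 1) fun _ => zero_le_one
  simpa using this

theorem le_card_closedBall (hT : T.IsTree) {d : ℕ} (hd : 3 ≤ d)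
    (hreg : T.IsRegularOfDegree d) (c : Fin k → V) (r : ℕ) :
    (d - 1) ^ r * (comps k r).card ≤ (closedBall (power T k) c r).card := by
  classical
  have hc := hT.connected
  have hsub : (comps k r).biUnion (fun a => Fintype.piFinset fun i => sphere T (c i) (a i)) ⊆
      closedBall (power T k) c r := by
    intro x hx
    obtain ⟨a, ha, hx⟩ := Finset.mem_biUnion.1 hx
    rw [Fintype.mem_piFinset] at hx
    rw [mem_power_closedBall hc, ← mem_comps.1 ha]
    exact Finset.sum_le_sum fun i _ => ((mem_sphere hc).1 (hx i)).le
  refine le_trans ?_ (Finset.card_le_card hsub)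
  rw [Finset.card_biUnion]
  · rw [mul_comm, ← smul_eq_mul]
    refine Finset.card_nsmul_le_sum _ _ _ fun a ha => ?_
    rw [Fintype.card_piFinset, ← mem_comps.1 ha, ← Finset.prod_pow_eq_pow_sum]
    exact Finset.prod_le_prod' fun i _ => le_card_sphere hT hd hreg (c i) (a i)
  · intro a _ b _ hab
    rw [Function.onFun, Finset.disjoint_left]
    intro x hx hx'
    rw [Fintype.mem_piFinset] at hx hx'
    exact hab (funext fun i =>
      ((mem_sphere hc).1 (hx i)).symm.trans ((mem_sphere hc).1 (hx' i)))

theorem ballLoad_le (hT : T.IsTree) {d : ℕ} (hd : 3 ≤ d)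
    (hreg : T.IsRegularOfDegree d) (c : Fin k → V) (r : ℕ) :
    ballLoad (power T k) c r ≤ ∑ s ∈ Finset.range (r + 1), ∑ t ∈ Finset.range (r + 1),
      2 ^ k * ((d - 1 : ℕ) : ℝ) ^ s * (2 ^ k * ((d - 1 : ℕ) : ℝ) ^ t *
        (4 * ((comps k (s + t)).card * ((2 * k + 1) ^ k * (2 * k + 1) ^ k)))) := by
  classical
  let Φ : (Fin k → ℕ) → (Fin k → ℕ) → ℝ := fun a b =>
    4 * ((multi a * multi b : ℝ) / cellWeight (∑ i, a i) (∑ i, b i) (a, b))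
  have hΦ : ∀ a b, 0 ≤ Φ a b := fun a b =>
    mul_nonneg (by norm_num) (div_nonneg (by positivity) (cellWeight_nonneg _ _ _))
  have h1 : ballLoad (power T k) c r ≤ ∑ p ∈ (closedBall (power T k) c r).offDiag,
      Φ (profile T p.1 c) (profile T p.2 c) := by
    unfold ballLoad trafficLoad
    rw [← sum_offDiag_subtype (closedBall (power T k) c r)
      (fun u w => Φ (profile T u c) (profile T w c))]
    have h2 : ∑ p ∈ (Finset.univ : Finset {x // x ∈ closedBall (power T k) c r}).offDiag,
        flowThrough (ballGraph (power T k) c r) p.1 p.2 ⟨c, center_mem_closedBall _ c r⟩ ≤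
        ∑ p ∈ (Finset.univ : Finset {x // x ∈ closedBall (power T k) c r}).offDiag,
          Φ (profile T p.1.1 c) (profile T p.2.1 c) :=
      Finset.sum_le_sum fun p _ => flowThrough_ball_le hT c r p.1 p.2
    have h3 : 0 ≤ ∑ p ∈ (Finset.univ : Finset {x // x ∈ closedBall (power T k) c r}).offDiag,
        flowThrough (ballGraph (power T k) c r) p.1 p.2 ⟨c, center_mem_closedBall _ c r⟩ :=
      Finset.sum_nonneg fun p _ => flowThrough_nonneg _ _ _
    have h4 : (1 / 2 : ℝ) * ∑ p ∈ (Finset.univ :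
        Finset {x // x ∈ closedBall (power T k) c r}).offDiag,
        flowThrough (ballGraph (power T k) c r) p.1 p.2 ⟨c, center_mem_closedBall _ c r⟩ ≤
        ∑ p ∈ (Finset.univ : Finset {x // x ∈ closedBall (power T k) c r}).offDiag,
          Φ (profile T p.1.1 c) (profile T p.2.1 c) := by linarith
    convert h4
  refine h1.trans ?_
  refine (Finset.sum_le_sum_of_subset_of_nonneg (t := closedBall (power T k) c r ×ˢ
    closedBall (power T k) c r) (fun p hp => ?_) fun p _ _ => hΦ _ _).trans ?_
  · rw [Finset.mem_offDiag] at hp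
    exact Finset.mem_product.2 ⟨hp.1, hp.2.1⟩
  rw [Finset.sum_product]
  refine (Finset.sum_le_sum fun x _ =>
    sum_closedBall_profile_le hT hd hreg c r (Φ (profile T x c)) (hΦ _)).trans ?_
  refine (sum_closedBall_profile_le hT hd hreg c r (fun a => ∑ t ∈ Finset.range (r + 1),
    2 ^ k * ((d - 1 : ℕ) : ℝ) ^ t * ∑ b ∈ comps k t, Φ a b) fun a =>
      Finset.sum_nonneg fun t _ => mul_nonneg (by positivity)
        (Finset.sum_nonneg fun b _ => hΦ a b)).trans ?_
  refine Finset.sum_le_sum fun s _ => ?_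
  rw [Finset.sum_comm, Finset.mul_sum]
  refine Finset.sum_le_sum fun t _ => ?_
  rw [← Finset.mul_sum]
  refine mul_le_mul_of_nonneg_left (mul_le_mul_of_nonneg_left ?_ (by positivity)) (by positivity)
  rw [← Finset.sum_product' (f := Φ)]
  refine le_trans (le_of_eq ?_)
    (mul_le_mul_of_nonneg_left (sum_div_cellWeight_le k s t) (by norm_num))
  rw [Finset.mul_sum]
  refine Finset.sum_congr rfl fun p hp => ?_
  rw [Finset.mem_product, mem_comps, mem_comps] at hp
  simp only [Φ, hp.1, hp.2]

/-- The load is bounded below by the pairs of vertices at distance `r` from the centre that lie, in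
every component, in complementary branches at the centre. -/
theorem le_trafficLoad (hT : T.IsTree) {d : ℕ} (hd : 3 ≤ d)
    (hreg : T.IsRegularOfDegree d) (c : Fin k → V) {r : ℕ} (hr : 1 ≤ r) :
    ((d - 1 : ℕ) : ℝ) ^ (2 * r) * (comps k (2 * r)).card ≤
      2 * ((d - 1 : ℕ) : ℝ) ^ k *
        trafficLoad (power T k) (closedBall (power T k) c r) c := by
  classical
  have hc := hT.connected
  choose q hq using fun i => exists_adj_of_regular hd hreg (c i)
  let U : (Fin k → ℕ) → Finset (Fin k → V) := fun a =>
    Fintype.piFinset fun i => branch T (c i) (q i) (a i)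
  let W : (Fin k → ℕ) → Finset (Fin k → V) := fun b =>
    Fintype.piFinset fun i => coBranch T (c i) (q i) (b i)
  have hU : ∀ {a x}, x ∈ U a → profile T x c = a := fun {a x} hx => by
    rw [Fintype.mem_piFinset] at hx
    exact funext fun i => ((mem_branch hc).1 (hx i)).1
  have hW : ∀ {b y}, y ∈ W b → profile T y c = b := fun {b y} hy => by
    rw [Fintype.mem_piFinset] at hy
    exact funext fun i => dist_of_mem_coBranch hT (hy i)
  have hUW : ∀ {a b x y}, x ∈ U a → y ∈ W b → profile T x y = a + b := by
    intro a b x y hx hy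
    have h1 := hU hx
    have h2 := hW hy
    rw [Fintype.mem_piFinset] at hx hy
    rw [← h1, ← h2, profile_comm y]
    exact funext fun i => dist_branch_coBranch hT (hq i) (hx i) (hy i)
  have hsub : (comps k r ×ˢ comps k r).biUnion (fun p => U p.1 ×ˢ W p.2) ⊆
      (closedBall (power T k) c r).offDiag := by
    rintro ⟨x, y⟩ hxy
    obtain ⟨⟨a, b⟩, hab, hxy⟩ := Finset.mem_biUnion.1 hxy
    rw [Finset.mem_product, mem_comps, mem_comps] at hab
    rw [Finset.mem_product] at hxy
    have h1 := hU hxy.1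
    have h2 := hW hxy.2
    have h3 := hUW hxy.1 hxy.2
    dsimp only at hab h1 h2 h3
    rw [Finset.mem_offDiag, mem_power_closedBall hc, mem_power_closedBall hc]
    refine ⟨by rw [h1, hab.1], by rw [h2, hab.2], ?_⟩
    dsimp only
    -- The distance of `x` and `y` is `2 * r`, so they are distinct as `1 ≤ r`.
    rintro rfl
    have h4 : ∑ i, (a + b) i = 0 := by rw [← h3, profile_self]; simp
    simp only [Pi.add_apply, Finset.sum_add_distrib] at h4
    omega
  have hdisj : Set.PairwiseDisjoint (↑(comps k r ×ˢ comps k r))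
      (fun p : (Fin k → ℕ) × (Fin k → ℕ) => U p.1 ×ˢ W p.2) := by
    intro p _ p' _ hne
    rw [Function.onFun, Finset.disjoint_left]
    rintro ⟨x, y⟩ hx hx'
    rw [Finset.mem_product] at hx hx'
    exact hne (Prod.ext ((hU hx.1).symm.trans (hU hx'.1)) ((hW hx.2).symm.trans (hW hx'.2)))
  have hflow : ∀ {a b x y}, x ∈ U a → y ∈ W b →
      flowThrough (power T k) x y c = (multi a * multi b : ℝ) / multi (a + b) := by
    intro a b x y hx hy
    rw [flowThrough_of_between, geoCount_power hT, geoCount_power hT, geoCount_power hT,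
      hUW hx hy, hU hx, profile_comm c, hW hy]
    rw [power_dist hc, power_dist hc, power_dist hc, hUW hx hy, hU hx, profile_comm c, hW hy,
      ← Finset.sum_add_distrib]
    rfl
  have hcard : ∀ p ∈ comps k r ×ˢ comps k r,
      ((d - 1 : ℕ) : ℝ) ^ (2 * r) ≤ ((d - 1 : ℕ) : ℝ) ^ k * (U p.1 ×ˢ W p.2).card := by
    rintro ⟨a, b⟩ hp
    rw [Finset.mem_product, mem_comps, mem_comps] at hp
    have h1 : (U a).card = (d - 1) ^ r := by
      rw [Fintype.card_piFinset, Finset.prod_congr rfl fun i _ => card_branch hT hreg (hq i) (a i),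
        Finset.prod_pow_eq_pow_sum, hp.1]
    have h2 : (d - 1) ^ r ≤ (d - 1) ^ k * (W b).card := by
      rw [← hp.2, ← Finset.prod_pow_eq_pow_sum, Fintype.card_piFinset]
      refine (Finset.prod_le_prod' fun i _ =>
        pow_le_card_coBranch hT hd hreg (hq i) (b i)).trans (le_of_eq ?_)
      rw [Finset.prod_mul_distrib, Finset.prod_const, Finset.card_univ, Fintype.card_fin]
    rw [Finset.card_product, h1]
    have h3 : (d - 1) ^ (2 * r) ≤ (d - 1) ^ k * ((d - 1) ^ r * (W b).card) := by
      calc (d - 1) ^ (2 * r) = (d - 1) ^ r * (d - 1) ^ r := by rw [two_mul, pow_add]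
        _ ≤ (d - 1) ^ r * ((d - 1) ^ k * (W b).card) := Nat.mul_le_mul_left _ h2
        _ = _ := by ring
    exact_mod_cast h3
  have hload : ∑ p ∈ comps k r ×ˢ comps k r,
      ((U p.1 ×ˢ W p.2).card : ℝ) * ((multi p.1 * multi p.2 : ℝ) / multi (p.1 + p.2)) ≤
        2 * trafficLoad (power T k) (closedBall (power T k) c r) c := by
    have h1 := Finset.sum_le_sum_of_subset_of_nonneg hsub
      (f := fun p => flowThrough (power T k) p.1 p.2 c) fun p _ _ => flowThrough_nonneg _ _ _
    rw [Finset.sum_biUnion hdisj] at h1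
    have h2 : 2 * trafficLoad (power T k) (closedBall (power T k) c r) c
        = ∑ p ∈ (closedBall (power T k) c r).offDiag, flowThrough (power T k) p.1 p.2 c := by
      unfold trafficLoad
      rw [← mul_assoc]
      norm_num
    rw [h2]
    refine le_trans (le_of_eq (Finset.sum_congr rfl fun p _ => ?_)) h1
    rw [Finset.sum_congr rfl fun x hx => hflow (Finset.mem_product.1 hx).1
      (Finset.mem_product.1 hx).2, Finset.sum_const, nsmul_eq_mul]
  rw [two_mul r, ← sum_multi_mul_multi_div, ← two_mul, Finset.mul_sum]
  calc _ ≤ ∑ p ∈ comps k r ×ˢ comps k r, ((d - 1 : ℕ) : ℝ) ^ k *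
        (((U p.1 ×ˢ W p.2).card : ℝ) * ((multi p.1 * multi p.2 : ℝ) / multi (p.1 + p.2))) := by
        refine Finset.sum_le_sum fun p hp => ?_
        rw [← mul_assoc]
        exact mul_le_mul_of_nonneg_right (hcard p hp) (by positivity)
    _ ≤ ((d - 1 : ℕ) : ℝ) ^ k *
        (2 * trafficLoad (power T k) (closedBall (power T k) c r) c) := by
        rw [← Finset.mul_sum]
        exact mul_le_mul_of_nonneg_left hload (by positivity)
    _ = _ := by ring

end Flow

/-! ### Asymptotics -/

theorem isTheta_of_two_sided_bound {f h : ℕ → ℝ} {a b : ℝ} (ha : 0 < a) (hh : ∀ r, 0 ≤ h r)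
    (h1 : ∀ r, 1 ≤ r → a * h r ≤ f r) (h2 : ∀ r, 1 ≤ r → f r ≤ b * h r) : f =Θ[atTop] h := by
  constructor
  · refine IsBigO.of_bound b ?_
    filter_upwards [eventually_ge_atTop 1] with r hr
    have h3 : 0 ≤ f r := (mul_nonneg ha.le (hh r)).trans (h1 r hr)
    rw [Real.norm_of_nonneg h3, Real.norm_of_nonneg (hh r)]
    exact h2 r hr
  · refine IsBigO.of_bound a⁻¹ ?_
    filter_upwards [eventually_ge_atTop 1] with r hr
    have h3 : 0 ≤ f r := (mul_nonneg ha.le (hh r)).trans (h1 r hr)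
    rw [Real.norm_of_nonneg h3, Real.norm_of_nonneg (hh r), inv_mul_eq_div, le_div_iff₀ ha,
      mul_comm]
    exact h1 r hr

theorem sum_range_pow_le {q : ℝ} (hq : 2 ≤ q) (r : ℕ) :
    ∑ s ∈ Finset.range (r + 1), q ^ s ≤ 2 * q ^ r := by
  induction r with
  | zero => simp
  | succ r ih =>
    rw [Finset.sum_range_succ]
    have : 0 ≤ q ^ r := by positivity
    have : 2 * q ^ r ≤ q ^ (r + 1) := by rw [pow_succ']; gcongr
    linarith

section Asymptotic

variable {V : Type*} {T : SimpleGraph V} {k : ℕ} [T.LocallyFinite]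

theorem card_closedBall_upper (hT : T.IsTree) {d : ℕ} (hd : 3 ≤ d) (hk : 1 ≤ k)
    (hreg : T.IsRegularOfDegree d) (c : Fin k → V) {r : ℕ} (hr : 1 ≤ r) :
    ((closedBall (power T k) c r).card : ℝ) ≤
      2 ^ (2 * k) * ((r : ℝ) ^ (k - 1) * ((d - 1 : ℕ) : ℝ) ^ r) := by
  have hq : (2 : ℝ) ≤ ((d - 1 : ℕ) : ℝ) := by exact_mod_cast (by omega : 2 ≤ d - 1)
  have hterm : ∀ s ∈ Finset.range (r + 1),
      2 ^ k * ((d - 1 : ℕ) : ℝ) ^ s * (comps k s).card ≤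
        2 ^ k * (2 * r : ℝ) ^ (k - 1) * ((d - 1 : ℕ) : ℝ) ^ s := by
    intro s hs
    rw [Finset.mem_range] at hs
    have h1 : (comps k s).card ≤ (2 * r) ^ (k - 1) :=
      (card_comps_le hk s).trans (Nat.pow_le_pow_left (by omega) _)
    have h2 : ((comps k s).card : ℝ) ≤ (2 * r : ℝ) ^ (k - 1) := by exact_mod_cast h1
    calc _ ≤ 2 ^ k * ((d - 1 : ℕ) : ℝ) ^ s * (2 * r : ℝ) ^ (k - 1) := by gcongr
      _ = _ := by ring
  calc ((closedBall (power T k) c r).card : ℝ) ≤ _ := card_closedBall_le hT hd hreg c r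
    _ ≤ _ := Finset.sum_le_sum hterm
    _ = 2 ^ k * (2 * r : ℝ) ^ (k - 1) * ∑ s ∈ Finset.range (r + 1), ((d - 1 : ℕ) : ℝ) ^ s := by
      rw [Finset.mul_sum]
    _ ≤ 2 ^ k * (2 * r : ℝ) ^ (k - 1) * (2 * ((d - 1 : ℕ) : ℝ) ^ r) := by
      gcongr
      exact sum_range_pow_le hq r
    _ = 2 ^ (2 * k) * ((r : ℝ) ^ (k - 1) * ((d - 1 : ℕ) : ℝ) ^ r) := by
      have : (2 : ℝ) ^ (2 * k) = 2 ^ k * (2 ^ (k - 1) * 2) := by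
        rw [← pow_succ, Nat.sub_add_cancel hk, two_mul, pow_add]
      rw [this, mul_pow]
      ring

theorem card_closedBall_lower (hT : T.IsTree) {d : ℕ} (hd : 3 ≤ d) (hk : 1 ≤ k)
    (hreg : T.IsRegularOfDegree d) (c : Fin k → V) (r : ℕ) :
    (r : ℝ) ^ (k - 1) * ((d - 1 : ℕ) : ℝ) ^ r ≤
      (k : ℝ) ^ (k - 1) * (closedBall (power T k) c r).card := by
  have h : r ^ (k - 1) * (d - 1) ^ r ≤ k ^ (k - 1) * (closedBall (power T k) c r).card :=
    calc _ ≤ k ^ (k - 1) * (comps k r).card * (d - 1) ^ r :=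
          Nat.mul_le_mul_right _ (pow_le_card_comps hk r)
      _ = k ^ (k - 1) * ((d - 1) ^ r * (comps k r).card) := by ring
      _ ≤ _ := Nat.mul_le_mul_left _ (le_card_closedBall hT hd hreg c r)
  exact_mod_cast h

theorem le_logb_card_closedBall (hT : T.IsTree) {d : ℕ} (hd : 3 ≤ d) (hk : 1 ≤ k)
    (hreg : T.IsRegularOfDegree d) (c : Fin k → V) (r : ℕ) :
    (r : ℝ) ≤ Real.logb ((d - 1 : ℕ) : ℝ) (closedBall (power T k) c r).card := by
  have hq : (1 : ℝ) < ((d - 1 : ℕ) : ℝ) := by exact_mod_cast (by omega : 1 < d - 1)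
  have hpos : (0 : ℝ) < (closedBall (power T k) c r).card := by
    exact_mod_cast Finset.card_pos.2 ⟨c, center_mem_closedBall _ c r⟩
  rw [Real.le_logb_iff_rpow_le hq hpos, Real.rpow_natCast]
  have h1 : 0 < (comps k r).card := by
    refine Finset.card_pos.2 ⟨fun i => if i = ⟨0, hk⟩ then r else 0, mem_comps.2 ?_⟩
    simp
  have h2 : (d - 1) ^ r ≤ (closedBall (power T k) c r).card :=
    (Nat.le_mul_of_pos_right _ h1).trans (le_card_closedBall hT hd hreg c r)
  exact_mod_cast h2

theorem logb_card_closedBall_le (hT : T.IsTree) {d : ℕ} (hd : 3 ≤ d) (hk : 1 ≤ k)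
    (hreg : T.IsRegularOfDegree d) (c : Fin k → V) {r : ℕ} (hr : 1 ≤ r) :
    Real.logb ((d - 1 : ℕ) : ℝ) (closedBall (power T k) c r).card ≤ 3 * k * r := by
  have hq2 : (2 : ℝ) ≤ ((d - 1 : ℕ) : ℝ) := by exact_mod_cast (by omega : 2 ≤ d - 1)
  have hq : (1 : ℝ) < ((d - 1 : ℕ) : ℝ) := by linarith
  have hpos : (0 : ℝ) < (closedBall (power T k) c r).card := by
    exact_mod_cast Finset.card_pos.2 ⟨c, center_mem_closedBall _ c r⟩
  have hcast : (3 * k * r : ℝ) = ((3 * k * r : ℕ) : ℝ) := by push_cast; ring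
  rw [hcast, Real.logb_le_iff_le_rpow hq hpos, Real.rpow_natCast]
  have hrq : (r : ℝ) ≤ ((d - 1 : ℕ) : ℝ) ^ r := by
    exact_mod_cast (Nat.lt_pow_self (by omega : 1 < d - 1)).le
  calc ((closedBall (power T k) c r).card : ℝ)
      ≤ 2 ^ (2 * k) * ((r : ℝ) ^ (k - 1) * ((d - 1 : ℕ) : ℝ) ^ r) :=
        card_closedBall_upper hT hd hk hreg c hr
    _ ≤ ((d - 1 : ℕ) : ℝ) ^ (2 * k) *
        ((((d - 1 : ℕ) : ℝ) ^ r) ^ (k - 1) * ((d - 1 : ℕ) : ℝ) ^ r) := by gcongr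
    _ = ((d - 1 : ℕ) : ℝ) ^ (2 * k + r * k) := by
      rw [← pow_succ, Nat.sub_add_cancel hk, ← pow_mul, ← pow_add]
    _ ≤ ((d - 1 : ℕ) : ℝ) ^ (3 * k * r) := by
      refine pow_le_pow_right₀ hq.le ?_
      have : 2 * k ≤ 2 * k * r := Nat.le_mul_of_pos_right _ hr
      linarith

/-- The claimed order of magnitude is `r ^ (k - 1) * (d - 1) ^ (2 * r)`. -/
theorem target_isTheta (hT : T.IsTree) {d : ℕ} (hd : 3 ≤ d) (hk : 1 ≤ k)
    (hreg : T.IsRegularOfDegree d) (c : Fin k → V) :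
    (fun r : ℕ => ((closedBall (power T k) c r).card : ℝ) ^ 2 /
        Real.logb ((d - 1 : ℕ) : ℝ) (closedBall (power T k) c r).card ^ (k - 1)) =Θ[atTop]
      fun r : ℕ => (r : ℝ) ^ (k - 1) * ((d - 1 : ℕ) : ℝ) ^ (2 * r) := by
  have hk' : (0 : ℝ) < k := by exact_mod_cast hk
  refine isTheta_of_two_sided_bound
    (a := (((k : ℝ) ^ (k - 1)) ^ 2 * (3 * k : ℝ) ^ (k - 1))⁻¹) (b := (2 ^ (2 * k)) ^ 2)
    (by positivity) (fun r => by positivity) ?_ ?_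
  · intro r hr
    have hr' : (0 : ℝ) < r := by exact_mod_cast hr
    have h1 := le_logb_card_closedBall hT hd hk hreg c r
    have h2 := logb_card_closedBall_le hT hd hk hreg c hr
    have h3 := card_closedBall_lower hT hd hk hreg c r
    set L := Real.logb ((d - 1 : ℕ) : ℝ) (closedBall (power T k) c r).card
    have hL : 0 < L := hr'.trans_le h1
    rw [inv_mul_le_iff₀ (by positivity), mul_div_assoc', le_div_iff₀ (by positivity)]
    calc _ ≤ (r : ℝ) ^ (k - 1) * ((d - 1 : ℕ) : ℝ) ^ (2 * r) * (3 * k * r) ^ (k - 1) := by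
          gcongr
      _ = ((r : ℝ) ^ (k - 1) * ((d - 1 : ℕ) : ℝ) ^ r) ^ 2 * (3 * k) ^ (k - 1) := by
          rw [mul_pow (3 * k : ℝ), mul_comm 2 r, pow_mul]
          ring
      _ ≤ ((k : ℝ) ^ (k - 1) * (closedBall (power T k) c r).card) ^ 2 * (3 * k) ^ (k - 1) := by
          gcongr
      _ = _ := by ring
  · intro r hr
    have hr' : (0 : ℝ) < r := by exact_mod_cast hr
    have h1 := le_logb_card_closedBall hT hd hk hreg c r
    have h3 := card_closedBall_upper hT hd hk hreg c hr
    set L := Real.logb ((d - 1 : ℕ) : ℝ) (closedBall (power T k) c r).card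
    have hL : 0 < L := hr'.trans_le h1
    rw [div_le_iff₀ (by positivity)]
    calc ((closedBall (power T k) c r).card : ℝ) ^ 2
        ≤ (2 ^ (2 * k) * ((r : ℝ) ^ (k - 1) * ((d - 1 : ℕ) : ℝ) ^ r)) ^ 2 := by gcongr
      _ = (2 ^ (2 * k)) ^ 2 * ((r : ℝ) ^ (k - 1) * ((d - 1 : ℕ) : ℝ) ^ (2 * r)) *
          (r : ℝ) ^ (k - 1) := by
        rw [mul_comm 2 r, pow_mul ((d - 1 : ℕ) : ℝ)]
        ring
      _ ≤ _ := by gcongr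

theorem trafficLoad_lower (hT : T.IsTree) {d : ℕ} (hd : 3 ≤ d) (hk : 1 ≤ k)
    (hreg : T.IsRegularOfDegree d) (c : Fin k → V) {r : ℕ} (hr : 1 ≤ r) :
    (2 * ((d - 1 : ℕ) : ℝ) ^ k * (k : ℝ) ^ (k - 1))⁻¹ *
        ((r : ℝ) ^ (k - 1) * ((d - 1 : ℕ) : ℝ) ^ (2 * r)) ≤
      trafficLoad (power T k) (closedBall (power T k) c r) c := by
  have hk' : (0 : ℝ) < k := by exact_mod_cast hk
  have hq : (0 : ℝ) < ((d - 1 : ℕ) : ℝ) := by exact_mod_cast (by omega : 0 < d - 1)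
  have h1 : (r : ℝ) ^ (k - 1) ≤ (k : ℝ) ^ (k - 1) * (comps k (2 * r)).card := by
    exact_mod_cast (Nat.pow_le_pow_left (by omega : r ≤ 2 * r) _).trans
      (pow_le_card_comps hk (2 * r))
  rw [inv_mul_le_iff₀ (by positivity)]
  calc (r : ℝ) ^ (k - 1) * ((d - 1 : ℕ) : ℝ) ^ (2 * r)
      ≤ (k : ℝ) ^ (k - 1) * (comps k (2 * r)).card * ((d - 1 : ℕ) : ℝ) ^ (2 * r) := by gcongr
    _ = (k : ℝ) ^ (k - 1) * (((d - 1 : ℕ) : ℝ) ^ (2 * r) * (comps k (2 * r)).card) := by ring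
    _ ≤ (k : ℝ) ^ (k - 1) * (2 * ((d - 1 : ℕ) : ℝ) ^ k *
        trafficLoad (power T k) (closedBall (power T k) c r) c) :=
      mul_le_mul_of_nonneg_left (le_trafficLoad hT hd hreg c hr) (by positivity)
    _ = _ := by ring

theorem ballLoad_upper (hT : T.IsTree) {d : ℕ} (hd : 3 ≤ d) (hk : 1 ≤ k)
    (hreg : T.IsRegularOfDegree d) (c : Fin k → V) {r : ℕ} (hr : 1 ≤ r) :
    ballLoad (power T k) c r ≤
      2 ^ k * (2 ^ k * (4 * (3 ^ (k - 1) * ((2 * k + 1) ^ k * (2 * k + 1) ^ k)))) * 4 *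
        ((r : ℝ) ^ (k - 1) * ((d - 1 : ℕ) : ℝ) ^ (2 * r)) := by
  have hq : (2 : ℝ) ≤ ((d - 1 : ℕ) : ℝ) := by exact_mod_cast (by omega : 2 ≤ d - 1)
  set q : ℝ := ((d - 1 : ℕ) : ℝ)
  set K : ℝ := (2 * k + 1) ^ k * (2 * k + 1) ^ k with hK
  have hK0 : 0 ≤ K := by positivity
  have hterm : ∀ s ∈ Finset.range (r + 1), ∀ t ∈ Finset.range (r + 1),
      2 ^ k * q ^ s * (2 ^ k * q ^ t * (4 * ((comps k (s + t)).card * K))) ≤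
        2 ^ k * (2 ^ k * (4 * (3 ^ (k - 1) * K))) * (r : ℝ) ^ (k - 1) * (q ^ s * q ^ t) := by
    intro s hs t ht
    rw [Finset.mem_range] at hs ht
    have h1 : (comps k (s + t)).card ≤ (3 * r) ^ (k - 1) :=
      (card_comps_le hk _).trans (Nat.pow_le_pow_left (by omega) _)
    have h2 : ((comps k (s + t)).card : ℝ) ≤ (3 * r : ℝ) ^ (k - 1) := by exact_mod_cast h1
    calc _ ≤ 2 ^ k * q ^ s * (2 ^ k * q ^ t * (4 * ((3 * r : ℝ) ^ (k - 1) * K))) := by gcongr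
      _ = _ := by rw [mul_pow]; ring
  refine (ballLoad_le hT hd hreg c r).trans ((Finset.sum_le_sum fun s hs =>
    Finset.sum_le_sum fun t ht => hterm s hs t ht).trans ?_)
  simp only [← Finset.mul_sum, ← Finset.sum_mul]
  have hsum := sum_range_pow_le hq r
  have hsum0 : 0 ≤ ∑ s ∈ Finset.range (r + 1), q ^ s := Finset.sum_nonneg fun _ _ => by positivity
  calc _ ≤ 2 ^ k * (2 ^ k * (4 * (3 ^ (k - 1) * K))) * (r : ℝ) ^ (k - 1) *
        ((2 * q ^ r) * (2 * q ^ r)) := by gcongr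
    _ = _ := by
      rw [mul_comm 2 r, pow_mul]
      ring

end Asymptotic

end ProductTraffic

theorem mainTheorem2 {V : Type*} (T : SimpleGraph V) [T.LocallyFinite] (d k : ℕ)
    (hd : 3 ≤ d) (hk : 1 ≤ k) (hT : T.IsTree) (hreg : T.IsRegularOfDegree d)
    (vstar : Fin k → V) :
    ((fun r : ℕ => ProductTraffic.ballLoad (ProductTraffic.power T k) vstar r) =Θ[atTop]
      (fun r : ℕ => ((ProductTraffic.closedBall (ProductTraffic.power T k) vstar r).card : ℝ) ^ 2 /
        (Real.logb ((d : ℝ) - 1)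
          ((ProductTraffic.closedBall (ProductTraffic.power T k) vstar r).card : ℝ)) ^ (k - 1))) ∧
    ((fun r : ℕ => ProductTraffic.trafficLoad (ProductTraffic.power T k)
        (ProductTraffic.closedBall (ProductTraffic.power T k) vstar r) vstar) =Θ[atTop]
      (fun r : ℕ => ((ProductTraffic.closedBall (ProductTraffic.power T k) vstar r).card : ℝ) ^ 2 /
        (Real.logb ((d : ℝ) - 1)
          ((ProductTraffic.closedBall (ProductTraffic.power T k) vstar r).card : ℝ)) ^ (k - 1))) := by
  have hcast : (d : ℝ) - 1 = ((d - 1 : ℕ) : ℝ) := by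
    rw [Nat.cast_sub (by omega), Nat.cast_one]
  have hk' : (0 : ℝ) < k := by exact_mod_cast hk
  have hq : (0 : ℝ) < ((d - 1 : ℕ) : ℝ) := by exact_mod_cast (by omega : 0 < d - 1)
  have htarget := ProductTraffic.target_isTheta hT hd hk hreg vstar
  have ha : (0 : ℝ) < (2 * ((d - 1 : ℕ) : ℝ) ^ k * (k : ℝ) ^ (k - 1))⁻¹ := by positivity
  rw [hcast]
  constructor
  · refine IsTheta.trans ?_ htarget.symm
    exact ProductTraffic.isTheta_of_two_sided_bound ha (fun r => by positivity)
      (fun r hr => (ProductTraffic.trafficLoad_lower hT hd hk hreg vstar hr).trans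
        (ProductTraffic.trafficLoad_le_ballLoad hT vstar r))
      fun r hr => ProductTraffic.ballLoad_upper hT hd hk hreg vstar hr
  · refine IsTheta.trans ?_ htarget.symm
    exact ProductTraffic.isTheta_of_two_sided_bound ha (fun r => by positivity)
      (fun r hr => ProductTraffic.trafficLoad_lower hT hd hk hreg vstar hr)
      fun r hr => (ProductTraffic.trafficLoad_le_ballLoad hT vstar r).trans
        (ProductTraffic.ballLoad_upper hT hd hk hreg vstar hr)
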